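/- Let $(\Omega,\mathcal F,\mathbb P)$ be a probability space, $p\in\mathbb N$, $\beta\in\mathbb R^p$, and let $x_{ij}$ ($i\ge 1$, $1\le j\le p$) be real constants. For $n\ge1$ let $\mathbf X_n=(x_{ij})_{1\le i\le n,1\le j\le p}$, and consider the multiple regression model $y_i=\sum_{j=1}^p x_{ij}\beta_j+\varepsilon_i$, $i\ge1$, where $\varepsilon_1,\varepsilon_2,\dots$ are identically distributed random variables that are pairwise positively quadrant dependent: $\mathbb P\{\varepsilon_k\le s,\varepsilon_j\le t\}-\mathbb P\{\varepsilon_k\le s\}\,\mathbb P\{\varepsilon_j\le t\}\ge0$ for all $k\ne j$ and all real $s,t$. Suppose that $\mathbb E|\varepsilon_1|^r<\infty$ for some $1\le r<2$ and that $\mathbb E\,\varepsilon_1=0$. Write $\operatorname{Log}x=\log(\max(|x|,\mathrm e))$, $g_t(s)=\max(\min(s,t),-t)$ and $G_{X,Y}(t)=\operatorname{Cov}(g_t(X),g_t(Y))$. Assume that $\mathbf X_n'\mathbf X_n$ is non-singular for some $n$ (hence for all larger $n$), that $\sup_{n\ge1}\frac1n\sum_{k=1}^n x_{kj}^2<\infty$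 for each $j$, and that one of the following holds: (i) $r=1$, $[(\mathbf X_n'\mathbf X_n)^{-1}]_{jj}=O(1/n)$ as $n\to\infty$ for each $j$, and for all $i,j\in\{1,\dots,p\}$ $$\sum_{1\le k<\ell<\infty}|x_{ki}x_{\ell j}|\int_\ell^\infty t^{-3}\,G_{\varepsilon_k,\varepsilon_\ell}(t)\,\mathrm dt<\infty;$$ (ii) $1<r<2$, $[(\mathbf X_n'\mathbf X_n)^{-1}]_{jj}=O\big(n^{-1/r}(\operatorname{Log}n)^{-1}\big)$ as $n\to\infty$ for each $j$, and there is $C>0$ such that for all $i,j\in\{1,\dots,p\}$ there is a real sequence $L_\ell=\frac{C\ell^{1/r}}{(\operatorname{Log}\ell)^{2/r}}+o\Big(\frac{\ell^{1/r}}{(\operatorname{Log}\ell)^{2/r}}\Big)$, $\ell\to\infty$, with $$\sum_{1\le k<\ell<\infty}|x_{ki}x_{\ell j}|\int_{L_\ell}^\infty\left[\frac1{t^3(\operatorname{Log}t)^2}+\frac1{\max(t,\mathrm e)\,t^2(\operatorname{Log}t)^3}\right]G_{\varepsilon_k,\varepsilon_\ell}(t)\,\mathrm dt<\infty.$$ Then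 the least-squares estimator $\widehat{\beta}_n=(\mathbf X_n'\mathbf X_n)^{-1}\mathbf X_n'(y_1,\dots,y_n)'$ (defined for all sufficiently large $n$) converges to $\beta$ almost surely as $n\to\infty$. -/

import Mathlib

open MeasureTheory ProbabilityTheory Filter Topology Asymptotics
open scoped ENNReal Matrix

noncomputable section

namespace PQDRegression

/-- `Log x = log (max |x| e)`. -/
def Log (x : ℝ) : ℝ := Real.log (max |x| (Real.exp 1))

/-- Truncation at level `l`: `g_l(t) = max (min t l) (-l)`. -/
def trunc (l t : ℝ) : ℝ := max (min t l) (-l)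

/-- `G_{X,Y}(t) = Cov (g_t(X), g_t(Y))`. -/
def truncCov {Ω : Type*} [MeasurableSpace Ω] (P : Measure Ω) (X Y : Ω → ℝ) (t : ℝ) : ℝ :=
  covariance (fun ω => trunc t (X ω)) (fun ω => trunc t (Y ω)) P

/-- The sequence `X 1, X 2, ...` is pairwise positively quadrant dependent.
Sequences are indexed from `1`; the value at index `0` plays no role. -/
def PairwisePQD {Ω : Type*} [MeasurableSpace Ω] (P : Measure Ω) (X : ℕ → Ω → ℝ) : Prop :=
  ∀ k j : ℕ, 1 ≤ k → 1 ≤ j → k ≠ j → ∀ s t : ℝ,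
    0 ≤ P.real {ω | X k ω ≤ s ∧ X j ω ≤ t} - P.real {ω | X k ω ≤ s} * P.real {ω | X j ω ≤ t}

/-- The `n × p` design matrix, whose rows are `x 1, ..., x n`. -/
def design {p : ℕ} (x : ℕ → Fin p → ℝ) (n : ℕ) : Matrix (Fin n) (Fin p) ℝ :=
  Matrix.of fun i j => x (i + 1) j

/-- The observation vector `(y 1, ..., y n)`. -/
def obs (y : ℕ → ℝ) (n : ℕ) : Fin n → ℝ := fun i => y (i + 1)

/-- The least-squares estimate `(X' X)⁻¹ X' y`. -/
def lsEstimate {n p : ℕ} (X : Matrix (Fin n) (Fin p) ℝ) (y : Fin n → ℝ) : Fin p → ℝ :=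
  (Xᵀ * X)⁻¹ *ᵥ (Xᵀ *ᵥ y)

/-- The sum over all `1 ≤ k < l` of `|a k * b l|` times the integral, over `t > L l`, of
`K t * G_{ε_k, ε_l}(t)`, as an element of `[0, ∞]` (under pairwise positive quadrant dependence
`G ≥ 0`). -/
def weightedCovSum {Ω : Type*} [MeasurableSpace Ω] (P : Measure Ω) (ε : ℕ → Ω → ℝ)
    (a b : ℕ → ℝ) (L : ℕ → ℝ) (K : ℝ → ℝ) : ℝ≥0∞ :=
  ∑' q : {q : ℕ × ℕ // 1 ≤ q.1 ∧ q.1 < q.2},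
    ENNReal.ofReal |a q.1.1 * b q.1.2| *
      ∫⁻ t in Set.Ioi (L q.1.2),
        ENNReal.ofReal (K t * truncCov P (ε q.1.1) (ε q.1.2) t)

/-- The sequence `l^{1/r} / Log^{2/r} l`. -/
def level (r : ℝ) (l : ℕ) : ℝ := (l : ℝ) ^ (1 / r) / Log l ^ (2 / r)

/-- The kernel `1 / (t³ Log² t) + 1 / (max(t, e) t² Log³ t)`. -/
def kernel (t : ℝ) : ℝ :=
  1 / (t ^ 3 * Log t ^ 2) + 1 / (max t (Real.exp 1) * t ^ 2 * Log t ^ 3)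

end PQDRegression

end

open PQDRegression

/-! The estimation error is `(X'X)⁻¹ X'ε`. The inverse Gram matrix is positive semidefinite, so its
diagonal bounds all its entries, and consistency reduces to a strong law `∑ a k * ε k = o(b n)` for
each column `a` of the design, with `b n = n` or `b n = n^{1/r} (2 + log n)`.

Dependence enters through one fact: increasing functions of a PQD pair have nonnegative covariance.
Hence the covariance of two clamped variables grows with the clamping intervals and is at most
`truncCov` at a common level (`PQD.covariance_clamp`). As `truncCov` is monotone in the level, the
integral hypothesis becomes a summability condition at level `T l` (`summable_of_weightedCovSum`);
with the truncated moments (`summable_truncated_moment`) this controls the second moments of partial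
sums.

For `r = 1`, truncation is at `k`, and splitting weights and noise by sign makes every product
nonnegative. Second moments give convergence along geometric subsequences, and Etemadi's
interpolation fills the gaps.

For `1 < r < 2`, the noise is cut at `cutoff r k = k^{1/r} / (2 + log k)` and at `k^{1/r}`. The core
obeys a Rademacher–Menshov law, whose logarithmic loss is the logarithm in `rate`. The excess
between the two levels, weighted by `|a k|`, has monotone sums and negligible mean, so powers of two
suffice. Exceedances of `k^{1/r}` stop almost surely by Borel–Cantelli. -/

namespace PQDRegression

/-! ### Covariance inequalities under positive quadrant dependence. -/

section PQD

variable {Ω : Type*} [MeasurableSpace Ω] {P : Measure Ω} [IsProbabilityMeasure P]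

/-- Positive quadrant dependence of a pair of random variables. -/
def PQD (P : Measure Ω) (X Y : Ω → ℝ) : Prop :=
  ∀ s t : ℝ, P.real {ω | X ω ≤ s} * P.real {ω | Y ω ≤ t} ≤ P.real {ω | X ω ≤ s ∧ Y ω ≤ t}

lemma PQD.self (X : Ω → ℝ) : PQD P X X := by
  intro s t
  rcases le_total s t with h | h
  · have : {ω | X ω ≤ s ∧ X ω ≤ t} = {ω | X ω ≤ s} := by
      ext ω; exact ⟨fun h => h.1, fun h' => ⟨h', h'.trans h⟩⟩
    rw [this]
    exact mul_le_of_le_one_right measureReal_nonneg measureReal_le_one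
  · have : {ω | X ω ≤ s ∧ X ω ≤ t} = {ω | X ω ≤ t} := by
      ext ω; exact ⟨fun h => h.2, fun h' => ⟨h'.trans h, h'⟩⟩
    rw [this]
    exact mul_le_of_le_one_left measureReal_nonneg measureReal_le_one

lemma PQD.Ioi {X Y : Ω → ℝ} (h : PQD P X Y) (hX : Measurable X) (hY : Measurable Y) (s t : ℝ) :
    P.real {ω | s < X ω} * P.real {ω | t < Y ω} ≤ P.real ({ω | s < X ω} ∩ {ω | t < Y ω}) := by
  have mA : MeasurableSet {ω | X ω ≤ s} := measurableSet_le hX measurable_const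
  have mB : MeasurableSet {ω | Y ω ≤ t} := measurableSet_le hY measurable_const
  have eA : {ω | s < X ω} = {ω | X ω ≤ s}ᶜ := by ext; simp
  have eB : {ω | t < Y ω} = {ω | Y ω ≤ t}ᶜ := by ext; simp
  have hst := h s t
  have e : {ω | X ω ≤ s ∧ Y ω ≤ t} = {ω | X ω ≤ s} ∩ {ω | Y ω ≤ t} := rfl
  rw [e] at hst
  rw [eA, eB, ← Set.compl_union, probReal_compl_eq_one_sub mA, probReal_compl_eq_one_sub mB,
    probReal_compl_eq_one_sub (mA.union mB)]
  have := measureReal_union_add_inter (μ := P) (s := {ω | X ω ≤ s}) mB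
  nlinarith

/-- Continuity makes the sublevel set closed, so its supremum, when finite, belongs to it. Events on
`f X` thus become ray events on `X`, where quadrant dependence applies. -/
lemma upperRay_of_monotone {f : ℝ → ℝ} (hf : Monotone f) (hc : Continuous f) (s : ℝ) :
    {x | s < f x} = ∅ ∨ {x | s < f x} = Set.univ ∨ ∃ a, {x | s < f x} = Set.Ioi a := by
  by_cases h0 : {x | f x ≤ s} = ∅
  · right; left
    ext x
    have : x ∉ {x | f x ≤ s} := by simp [h0]
    simpa using this
  by_cases hb : BddAbove {x | f x ≤ s}
  · right; right
    refine ⟨sSup {x | f x ≤ s}, ?_⟩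
    have hm : sSup {x | f x ≤ s} ∈ {x | f x ≤ s} :=
      (isClosed_le hc continuous_const).csSup_mem (Set.nonempty_iff_ne_empty.2 h0) hb
    ext x
    constructor
    · intro hx
      by_contra hcon
      exact absurd ((hf (not_lt.1 hcon)).trans hm) (not_le.2 hx)
    · intro hx
      by_contra hcon
      have hx' : x ∈ {x | f x ≤ s} := by simpa using hcon
      exact absurd (le_csSup hb hx') (not_le.2 hx)
  · left
    ext x
    simp only [Set.mem_ofPred_eq, Set.mem_empty_iff_false, iff_false, not_lt]
    rw [not_bddAbove_iff] at hb
    obtain ⟨y, hy, hxy⟩ := hb x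
    exact (hf hxy.le).trans hy

lemma PQD.superlevel {X Y : Ω → ℝ} (h : PQD P X Y) (hX : Measurable X) (hY : Measurable Y)
    {f g : ℝ → ℝ} (hf : Monotone f) (hfc : Continuous f) (hg : Monotone g) (hgc : Continuous g)
    (s t : ℝ) :
    P {ω | s < f (X ω)} * P {ω | t < g (Y ω)} ≤
      P ({ω | s < f (X ω)} ∩ {ω | t < g (Y ω)}) := by
  have e1 : {ω | s < f (X ω)} = X ⁻¹' {x | s < f x} := rfl
  have e2 : {ω | t < g (Y ω)} = Y ⁻¹' {x | t < g x} := rfl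
  rw [e1, e2]
  rcases upperRay_of_monotone hf hfc s with h1 | h1 | ⟨a, h1⟩ <;>
  rcases upperRay_of_monotone hg hgc t with h2 | h2 | ⟨b, h2⟩ <;> rw [h1, h2] <;> try simp
  have := h.Ioi hX hY a b
  simp only [measureReal_def] at this
  rw [← ENNReal.toReal_mul, ENNReal.toReal_le_toReal (by finiteness) (by finiteness)] at this
  exact this

lemma PQD.lintegral_mul {X Y : Ω → ℝ} (h : PQD P X Y) (hX : Measurable X) (hY : Measurable Y)
    {f g : ℝ → ℝ} (hf : Monotone f) (hfc : Continuous f) (hg : Monotone g) (hgc : Continuous g)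
    (hf0 : ∀ x, 0 ≤ f x) (hg0 : ∀ x, 0 ≤ g x) :
    (∫⁻ ω, ENNReal.ofReal (f (X ω)) ∂P) * ∫⁻ ω, ENNReal.ofReal (g (Y ω)) ∂P ≤
      ∫⁻ ω, ENNReal.ofReal (f (X ω)) * ENNReal.ofReal (g (Y ω)) ∂P := by
  have mF : Measurable fun ω => f (X ω) := hfc.measurable.comp hX
  have mG : Measurable fun ω => g (Y ω) := hgc.measurable.comp hY
  -- The level of `g` is frozen and the layer-cake formula is applied to `f`, under `P` and under
  -- its restriction.
  have hset : ∀ t, (∫⁻ ω, ENNReal.ofReal (f (X ω)) ∂P) * P {ω | t < g (Y ω)} ≤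
      ∫⁻ ω in {ω | t < g (Y ω)}, ENNReal.ofReal (f (X ω)) ∂P := by
    intro t
    rw [lintegral_eq_lintegral_meas_lt P (ae_of_all _ fun ω => hf0 _) mF.aemeasurable,
      lintegral_eq_lintegral_meas_lt _ (ae_of_all _ fun ω => hf0 _) mF.aemeasurable,
      ← lintegral_mul_const' _ _ (by finiteness)]
    refine lintegral_mono fun s => ?_
    rw [Measure.restrict_apply (measurableSet_lt measurable_const mF)]
    exact h.superlevel hX hY hf hfc hg hgc s t
  -- Viewing `f (X ω)` as a density allows a second layer-cake formula, now for `g`.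
  have e : ∫⁻ ω, ENNReal.ofReal (f (X ω)) * ENNReal.ofReal (g (Y ω)) ∂P =
      ∫⁻ ω, ENNReal.ofReal (g (Y ω)) ∂(P.withDensity fun ω => ENNReal.ofReal (f (X ω))) := by
    rw [lintegral_withDensity_eq_lintegral_mul _ mF.ennreal_ofReal mG.ennreal_ofReal]
    rfl
  have mμ : Measurable fun t : ℝ => P {ω | t < g (Y ω)} :=
    Antitone.measurable fun s t hst => measure_mono fun ω hω => lt_of_le_of_lt hst hω
  rw [e, lintegral_eq_lintegral_meas_lt P (ae_of_all _ fun ω => hg0 _) mG.aemeasurable,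
    lintegral_eq_lintegral_meas_lt _ (ae_of_all _ fun ω => hg0 _) mG.aemeasurable,
    ← lintegral_const_mul _ mμ]
  refine lintegral_mono fun t => ?_
  rw [withDensity_apply _ (measurableSet_lt measurable_const mG)]
  exact hset t

lemma memLp_bounded_comp {X : Ω → ℝ} (hX : Measurable X) {f : ℝ → ℝ} (hfc : Continuous f)
    {B : ℝ} (hB : ∀ x, |f x| ≤ B) (q : ℝ≥0∞) : MemLp (fun ω => f (X ω)) q P :=
  MemLp.of_bound (hfc.measurable.comp hX).aestronglyMeasurable B (ae_of_all _ fun _ => hB _)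

/-- Hoeffding's inequality: increasing functions of a positively quadrant dependent pair are
nonnegatively correlated. -/
lemma PQD.covariance_nonneg {X Y : Ω → ℝ} (h : PQD P X Y) (hX : Measurable X) (hY : Measurable Y)
    {f g : ℝ → ℝ} (hf : Monotone f) (hfc : Continuous f) (hg : Monotone g) (hgc : Continuous g)
    {B : ℝ} (hfB : ∀ x, |f x| ≤ B) (hgB : ∀ x, |g x| ≤ B) :
    0 ≤ cov[fun ω => f (X ω), fun ω => g (Y ω); P] := by
  have if1 := memLp_bounded_comp (P := P) hX hfc hfB
  have ig1 := memLp_bounded_comp (P := P) hY hgc hgB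
  -- Adding `B` leaves the covariance unchanged and makes both functions nonnegative, as the
  -- layer-cake argument requires.
  rw [← covariance_add_const_left ((if1 1).integrable le_rfl) B,
    ← covariance_add_const_right ((ig1 1).integrable le_rfl) B,
    covariance_eq_sub (X := fun ω => f (X ω) + B) (Y := fun ω => g (Y ω) + B)
      ((if1 2).add (memLp_const B)) ((ig1 2).add (memLp_const B)), sub_nonneg]
  have hf0 : ∀ x, 0 ≤ f x + B := fun x => by linarith [(abs_le.1 (hfB x)).1]
  have hg0 : ∀ x, 0 ≤ g x + B := fun x => by linarith [(abs_le.1 (hgB x)).1]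
  have key := h.lintegral_mul hX hY (f := fun x => f x + B) (g := fun x => g x + B)
    (hf.add_const B) (by fun_prop) (hg.add_const B) (by fun_prop) hf0 hg0
  have jf : Integrable (fun ω => f (X ω) + B) P :=
    ((if1 1).integrable le_rfl).add (integrable_const B)
  have jg : Integrable (fun ω => g (Y ω) + B) P :=
    ((ig1 1).integrable le_rfl).add (integrable_const B)
  have jfg : Integrable (fun ω => (f (X ω) + B) * (g (Y ω) + B)) P :=
    ((if1 2).add (memLp_const B)).integrable_mul ((ig1 2).add (memLp_const B))
  simp_rw [← ENNReal.ofReal_mul (hf0 _)] at key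
  rw [← ofReal_integral_eq_lintegral_ofReal jf (ae_of_all _ fun ω => hf0 _),
    ← ofReal_integral_eq_lintegral_ofReal jg (ae_of_all _ fun ω => hg0 _),
    ← ofReal_integral_eq_lintegral_ofReal jfg
      (ae_of_all _ fun ω => mul_nonneg (hf0 _) (hg0 _)),
    ← ENNReal.ofReal_mul (integral_nonneg fun ω => hf0 _)] at key
  exact (ENNReal.ofReal_le_ofReal_iff
    (integral_nonneg fun ω => mul_nonneg (hf0 _) (hg0 _))).1 key

/-- Bilinearity: `cov(F, G) - cov(f, g) = cov(F - f, G) + cov(f, G - g)`, and both terms pair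
increasing functions. -/
lemma PQD.covariance_mono {X Y : Ω → ℝ} (h : PQD P X Y) (hX : Measurable X) (hY : Measurable Y)
    {f g F G : ℝ → ℝ} (hf : Monotone f) (hfc : Continuous f) (hG : Monotone G)
    (hgc : Continuous g) (hFc : Continuous F) (hGc : Continuous G)
    (hfF : Monotone fun x => F x - f x) (hgG : Monotone fun x => G x - g x)
    {B : ℝ} (hfB : ∀ x, |f x| ≤ B) (hgB : ∀ x, |g x| ≤ B) (hFB : ∀ x, |F x| ≤ B)
    (hGB : ∀ x, |G x| ≤ B) :
    cov[fun ω => f (X ω), fun ω => g (Y ω); P] ≤ cov[fun ω => F (X ω), fun ω => G (Y ω); P] := by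
  have hB : 0 ≤ B := (abs_nonneg _).trans (hfB 0)
  have b1 : ∀ x, |F x - f x| ≤ 2 * B := fun x => by
    linarith [abs_sub (F x) (f x), hfB x, hFB x]
  have b2 : ∀ x, |G x - g x| ≤ 2 * B := fun x => by
    linarith [abs_sub (G x) (g x), hgB x, hGB x]
  have h1 := h.covariance_nonneg hX hY hfF (hFc.sub hfc) hG hGc b1
    (fun x => (hGB x).trans (by linarith))
  have h2 := h.covariance_nonneg hX hY hf hfc hgG (hGc.sub hgc)
    (fun x => (hfB x).trans (by linarith)) b2
  have mf := memLp_bounded_comp (P := P) hX hfc hfB 2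
  have mF := memLp_bounded_comp (P := P) hX hFc hFB 2
  have mg := memLp_bounded_comp (P := P) hY hgc hgB 2
  have mG := memLp_bounded_comp (P := P) hY hGc hGB 2
  rw [covariance_fun_sub_left mF mf mG] at h1
  rw [covariance_fun_sub_right mf mG mg] at h2
  linarith

/-- `clamp a b x` is the point of `[a, b]` closest to `x`. -/
def clamp (a b x : ℝ) : ℝ := max (min x b) a

lemma clamp_mono (a b : ℝ) : Monotone (clamp a b) := fun _ _ h => by
  unfold clamp; gcongr

lemma continuous_clamp (a b : ℝ) : Continuous (clamp a b) := by
  unfold clamp; fun_prop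

lemma abs_clamp_le {a b t : ℝ} (ha : -t ≤ a) (hab : a ≤ b) (hb : b ≤ t) (x : ℝ) :
    |clamp a b x| ≤ t := by
  unfold clamp
  rw [abs_le]
  exact ⟨ha.trans (le_max_right _ _), max_le ((min_le_right _ _).trans hb) (hab.trans hb)⟩

lemma clamp_sub_mono {a b c d : ℝ} (hca : c ≤ a) (hab : a ≤ b) (hbd : b ≤ d) :
    Monotone fun x => clamp c d x - clamp a b x := by
  intro x y hxy
  simp only [clamp]
  grind

lemma trunc_of_neg {t : ℝ} (ht : t ≤ 0) (x : ℝ) : trunc t x = -t := by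
  unfold trunc
  exact max_eq_right ((min_le_right _ _).trans (by linarith))

/-- Widening a clamping interval adds an increasing function, by `clamp_sub_mono`; the widest
interval allowed is `[-t, t]`, where `clamp` is `trunc`. -/
lemma PQD.covariance_clamp {X Y : Ω → ℝ} (h : PQD P X Y) (hX : Measurable X) (hY : Measurable Y)
    {a b a' b' t : ℝ} (ha : -t ≤ a) (hab : a ≤ b) (hb : b ≤ t)
    (ha' : -t ≤ a') (hab' : a' ≤ b') (hb' : b' ≤ t) :
    |cov[fun ω => clamp a b (X ω), fun ω => clamp a' b' (Y ω); P]| ≤ truncCov P X Y t := by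
  rw [abs_of_nonneg (h.covariance_nonneg hX hY (clamp_mono a b) (continuous_clamp a b)
    (clamp_mono a' b') (continuous_clamp a' b') (abs_clamp_le ha hab hb)
    (abs_clamp_le ha' hab' hb'))]
  exact h.covariance_mono hX hY (clamp_mono a b) (continuous_clamp a b) (clamp_mono (-t) t)
    (continuous_clamp a' b') (continuous_clamp (-t) t) (continuous_clamp (-t) t)
    (clamp_sub_mono ha hab hb) (clamp_sub_mono ha' hab' hb') (abs_clamp_le ha hab hb)
    (abs_clamp_le ha' hab' hb') (abs_clamp_le le_rfl (by linarith) le_rfl)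
    (abs_clamp_le le_rfl (by linarith) le_rfl)

lemma PQD.truncCov_nonneg {X Y : Ω → ℝ} (h : PQD P X Y) (hX : Measurable X) (hY : Measurable Y)
    (t : ℝ) : 0 ≤ truncCov P X Y t := by
  rcases le_total t 0 with ht | ht
  · simp only [truncCov, trunc_of_neg ht, covariance_const_left, le_refl]
  · exact (abs_nonneg _).trans (h.covariance_clamp hX hY (a := -t) (b := t) (a' := -t) (b' := t)
      le_rfl (by linarith) le_rfl le_rfl (by linarith) le_rfl)

lemma PQD.truncCov_mono {X Y : Ω → ℝ} (h : PQD P X Y) (hX : Measurable X) (hY : Measurable Y)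
    {s t : ℝ} (hs : 0 ≤ s) (hst : s ≤ t) : truncCov P X Y s ≤ truncCov P X Y t :=
  (le_abs_self _).trans (h.covariance_clamp hX hY (a := -s) (b := s) (a' := -s) (b' := s)
    (by linarith) (by linarith) hst (by linarith) (by linarith) hst)

end PQD

/-! ### Second moments of partial sums and a law of Rademacher–Menshov type. -/

noncomputable section SecondMoment

variable {Ω : Type*} [MeasurableSpace Ω] {P : Measure Ω}

lemma tendsto_zero_of_sq {u : ℕ → ℝ} (h : Tendsto (fun n => u n ^ 2) atTop (𝓝 0)) :
    Tendsto u atTop (𝓝 0) := by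
  have := (Real.continuous_sqrt.tendsto 0).comp h
  rw [Real.sqrt_zero] at this
  exact (tendsto_zero_iff_abs_tendsto_zero u).2 (this.congr fun n => Real.sqrt_sq_eq_abs _)

/-- The contribution of `Z l` to the second moment of `Z 1 + ⋯ + Z n`, for `l ≤ n`. -/
def rowMoment (P : Measure Ω) (Z : ℕ → Ω → ℝ) (l : ℕ) : ℝ :=
  ∫ ω, Z l ω ^ 2 ∂P + 2 * ∑ k ∈ Finset.Ioo 0 l, |∫ ω, Z k ω * Z l ω ∂P|

lemma rowMoment_nonneg (Z : ℕ → Ω → ℝ) (l : ℕ) : 0 ≤ rowMoment P Z l :=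
  add_nonneg (integral_nonneg fun _ => sq_nonneg _)
    (mul_nonneg zero_le_two (Finset.sum_nonneg fun _ _ => abs_nonneg _))

lemma memLp_sum_Ioc {Z : ℕ → Ω → ℝ} (hZ : ∀ k, 1 ≤ k → MemLp (Z k) 2 P) (m n : ℕ) :
    MemLp (fun ω => ∑ k ∈ Finset.Ioc m n, Z k ω) 2 P :=
  memLp_finsetSum _ fun k hk => hZ k (by have := Finset.mem_Ioc.1 hk; omega)

/-- Each row counts all earlier indices, even those before the block. The bound is therefore
additive over adjacent blocks, which the chaining argument needs. -/
lemma integral_block_sq_le {Z : ℕ → Ω → ℝ} (hZ : ∀ k, 1 ≤ k → MemLp (Z k) 2 P) (m n : ℕ) :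
    ∫ ω, (∑ k ∈ Finset.Ioc m n, Z k ω) ^ 2 ∂P ≤ ∑ l ∈ Finset.Ioc m n, rowMoment P Z l := by
  induction n with
  | zero => simp
  | succ n ih =>
    rcases Nat.lt_or_ge n m with h | h
    · rw [Finset.Ioc_eq_empty (by omega)]; simp
    simp_rw [Finset.sum_Ioc_succ_top h]
    have hz := hZ (n + 1) (by omega)
    have hA := memLp_sum_Ioc hZ m n
    have hprod : ∀ k ∈ Finset.Ioc m n, Integrable (fun ω => Z k ω * Z (n + 1) ω) P :=
      fun k hk => (hZ k (by have := Finset.mem_Ioc.1 hk; omega)).integrable_mul hz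
    have e : ∀ ω, (∑ k ∈ Finset.Ioc m n, Z k ω + Z (n + 1) ω) ^ 2 =
        (∑ k ∈ Finset.Ioc m n, Z k ω) ^ 2 +
          (2 * ∑ k ∈ Finset.Ioc m n, Z k ω * Z (n + 1) ω + Z (n + 1) ω ^ 2) := by
      intro ω; rw [← Finset.sum_mul]; ring
    have hs : Integrable (fun ω => ∑ k ∈ Finset.Ioc m n, Z k ω * Z (n + 1) ω) P :=
      integrable_finsetSum _ hprod
    have hs' : Integrable (fun ω => 2 * ∑ k ∈ Finset.Ioc m n, Z k ω * Z (n + 1) ω +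
        Z (n + 1) ω ^ 2) P := (hs.const_mul 2).add hz.integrable_sq
    simp_rw [e]
    rw [integral_add hA.integrable_sq hs', integral_add (hs.const_mul 2) hz.integrable_sq, integral_const_mul,
      integral_finsetSum _ hprod]
    have h1 : ∑ k ∈ Finset.Ioc m n, ∫ ω, Z k ω * Z (n + 1) ω ∂P ≤
        ∑ k ∈ Finset.Ioo 0 (n + 1), |∫ ω, Z k ω * Z (n + 1) ω ∂P| := by
      refine (Finset.sum_le_sum fun k _ => le_abs_self _).trans
        (Finset.sum_le_sum_of_subset_of_nonneg (fun k hk => ?_) fun _ _ _ => abs_nonneg _)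
      rw [Finset.mem_Ioc] at hk
      rw [Finset.mem_Ioo]; omega
    simp only [rowMoment] at ih ⊢
    linarith

/-- Exchange of summation: `h l` dominates the total weight of the `j` whose sum reaches `l`. -/
lemma summable_mul_sum_Ioc {v h d : ℕ → ℝ} {c : ℕ → ℕ} (hv : ∀ l, 0 ≤ v l) (hd : ∀ j, 0 ≤ d j)
    (hh : ∀ l, 0 ≤ h l)
    (hs : Summable fun l => h l * v l)
    (hdh : ∀ J l : ℕ, 1 ≤ l → ∑ j ∈ Finset.range J with l ≤ c j, d j ≤ h l) :
    Summable fun j => d j * ∑ l ∈ Finset.Ioc 0 (c j), v l := by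
  refine summable_of_sum_range_le (c := ∑' l, h l * v l)
    (fun j => mul_nonneg (hd j) (Finset.sum_nonneg fun l _ => hv l)) fun J => ?_
  set N := (Finset.range J).sup c
  have h1 : ∀ j ∈ Finset.range J, d j * ∑ l ∈ Finset.Ioc 0 (c j), v l =
      ∑ l ∈ Finset.Ioc 0 N, if l ≤ c j then d j * v l else 0 := by
    intro j hj
    have hcN : c j ≤ N := Finset.le_sup hj
    rw [Finset.mul_sum, ← Finset.sum_filter]
    refine Finset.sum_congr ?_ fun _ _ => rfl
    ext l
    simp only [Finset.mem_Ioc, Finset.mem_filter]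
    omega
  rw [Finset.sum_congr rfl h1, Finset.sum_comm]
  refine le_trans (Finset.sum_le_sum fun l hl => ?_)
    (hs.sum_le_tsum (Finset.Ioc 0 N) fun l _ => mul_nonneg (hh l) (hv l))
  rw [← Finset.sum_filter, ← Finset.sum_mul]
  exact mul_le_mul_of_nonneg_right (hdh J l (Finset.mem_Ioc.1 hl).1) (hv l)

/-- The sum of the series has finite expectation, so it converges almost surely and its terms
vanish. -/
lemma ae_tendsto_zero_of_summable_integral {f : ℕ → Ω → ℝ} (hf : ∀ j, Integrable (f j) P)
    (hf0 : ∀ j ω, 0 ≤ f j ω) (hs : Summable fun j => ∫ ω, f j ω ∂P) :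
    ∀ᵐ ω ∂P, Tendsto (fun j => f j ω) atTop (𝓝 0) := by
  have hm : ∀ j, AEMeasurable (fun ω => ENNReal.ofReal (f j ω)) P :=
    fun j => (hf j).aemeasurable.ennreal_ofReal
  have hfin : ∫⁻ ω, ∑' j, ENNReal.ofReal (f j ω) ∂P ≠ ∞ := by
    rw [lintegral_tsum hm]
    simp_rw [← ofReal_integral_eq_lintegral_ofReal (hf _) (ae_of_all _ (hf0 _))]
    exact hs.tsum_ofReal_ne_top
  filter_upwards [ae_lt_top' (AEMeasurable.tsum hm) hfin] with ω hω
  have h1 := ENNReal.tendsto_atTop_zero_of_tsum_ne_top hω.ne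
  have h2 := (ENNReal.tendsto_toReal ENNReal.zero_ne_top).comp h1
  simpa [Function.comp_def, ENNReal.toReal_ofReal (hf0 _ _)] using h2

lemma ae_tendsto_subseq {Z : ℕ → Ω → ℝ} (hZ : ∀ k, 1 ≤ k → MemLp (Z k) 2 P) {h b : ℕ → ℝ}
    {c : ℕ → ℕ} (hh : ∀ l, 0 ≤ h l)
    (hs : Summable fun l => h l * rowMoment P Z l)
    (hdh : ∀ J l : ℕ, 1 ≤ l → ∑ j ∈ Finset.range J with l ≤ c j, 1 / b j ^ 2 ≤ h l) :
    ∀ᵐ ω ∂P, Tendsto (fun j => (∑ k ∈ Finset.Ioc 0 (c j), Z k ω) / b j) atTop (𝓝 0) := by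
  have hd : ∀ j, 0 ≤ 1 / b j ^ 2 := fun j => by positivity
  have hsum := summable_mul_sum_Ioc (rowMoment_nonneg Z) hd hh hs hdh
  have key := ae_tendsto_zero_of_summable_integral (P := P)
    (f := fun j ω => 1 / b j ^ 2 * (∑ k ∈ Finset.Ioc 0 (c j), Z k ω) ^ 2)
    (fun j => (memLp_sum_Ioc hZ 0 (c j)).integrable_sq.const_mul _)
    (fun j ω => mul_nonneg (hd j) (sq_nonneg _)) (by
      refine Summable.of_nonneg_of_le (fun j => integral_nonneg fun ω =>
        mul_nonneg (hd j) (sq_nonneg _)) (fun j => ?_) hsum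
      rw [integral_const_mul]
      exact mul_le_mul_of_nonneg_left (integral_block_sq_le hZ 0 (c j)) (hd j))
  filter_upwards [key] with ω hω
  refine tendsto_zero_of_sq ?_
  refine hω.congr fun j => ?_
  rw [div_pow]; ring

/-- Clearing the binary digits of `N` one by one joins `N` to `0` in `m + 1` steps, each an
increment over at most one dyadic block. Cauchy–Schwarz gives the factor, and summing over all
blocks of each size makes the bound independent of `N`. -/
lemma sq_sub_le_dyadic (S : ℕ → ℝ) (m N : ℕ) (hN : N < 2 ^ (m + 1)) :
    (S N - S 0) ^ 2 ≤ (m + 1) * ∑ i ∈ Finset.range (m + 1), ∑ q ∈ Finset.range (2 ^ (m + 1 - i)),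
      (S ((q + 1) * 2 ^ i) - S (q * 2 ^ i)) ^ 2 := by
  set g : ℕ → ℝ := fun i => S (N / 2 ^ i * 2 ^ i)
  have h0 : S N - S 0 = ∑ i ∈ Finset.range (m + 1), (g i - g (i + 1)) := by
    rw [Finset.sum_range_sub']
    simp [g, Nat.div_eq_of_lt hN]
  rw [h0]
  refine sq_sum_le_card_mul_sum_sq.trans ?_
  rw [Finset.card_range]
  push_cast
  refine mul_le_mul_of_nonneg_left (Finset.sum_le_sum fun i hi => ?_) (by positivity)
  have hi' : i < m + 1 := Finset.mem_range.1 hi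
  have hnn : ∀ q ∈ Finset.range (2 ^ (m + 1 - i)),
      0 ≤ (S ((q + 1) * 2 ^ i) - S (q * 2 ^ i)) ^ 2 := fun _ _ => sq_nonneg _
  have e : N / 2 ^ (i + 1) * 2 ^ (i + 1) = (N / 2 ^ i / 2 * 2) * 2 ^ i := by
    rw [pow_succ, ← Nat.div_div_eq_div_mul]; ring
  simp only [g, e]
  set Q := N / 2 ^ i
  have hQ : Q < 2 ^ (m + 1 - i) := by
    refine Nat.div_lt_of_lt_mul ?_
    rwa [← pow_add, Nat.add_sub_cancel' hi'.le]
  -- An even `Q` has nothing to clear; an odd one loses exactly the block with index `Q - 1`.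
  rcases Nat.even_or_odd' Q with ⟨k, hk | hk⟩
  · have : Q / 2 * 2 = Q := by omega
    rw [this, sub_self]
    simpa using Finset.sum_nonneg hnn
  · have : Q / 2 * 2 = 2 * k := by omega
    rw [this, hk]
    exact Finset.single_le_sum (f := fun q => (S ((q + 1) * 2 ^ i) - S (q * 2 ^ i)) ^ 2) hnn
      (Finset.mem_range.2 (by omega : 2 * k < _))

lemma tendsto_natLog_two : Tendsto (fun n => Nat.log 2 n) atTop atTop :=
  tendsto_atTop_atTop_of_monotone Nat.log_monotone
    fun b => ⟨2 ^ b, (Nat.log_pow one_lt_two b).ge⟩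

/-- The normalisation `n^q (2 + log n)`. -/
def rate (q : ℝ) (n : ℕ) : ℝ := (n : ℝ) ^ q * (2 + Real.log n)

lemma two_add_log_pos (n : ℕ) : 0 < 2 + Real.log n := by
  have := Real.log_natCast_nonneg n
  linarith

lemma rate_pos {q : ℝ} {n : ℕ} (hn : 1 ≤ n) : 0 < rate q n := by
  have : (0 : ℝ) < n := by exact_mod_cast hn
  exact mul_pos (Real.rpow_pos_of_pos this q) (two_add_log_pos n)

lemma sum_inv_pow_sq_le {q : ℝ} (hq : 0 < q) :
    ∃ C : ℝ, 0 ≤ C ∧ ∀ J l : ℕ, 1 ≤ l →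
      ∑ j ∈ Finset.range J with l ≤ 2 ^ (j + 1), 1 / (((2 : ℝ) ^ q) ^ j) ^ 2 ≤
        C / ((l : ℝ) ^ q) ^ 2 := by
  have hc : (1 : ℝ) < 2 ^ q := Real.one_lt_rpow one_lt_two hq
  set c : ℝ := 2 ^ q
  refine ⟨c ^ 3 * (c - 1)⁻¹ * (2 * c) ^ 2, ?_, fun J l hl => ?_⟩
  · have : 0 < c - 1 := by linarith
    positivity
  have hl0 : (0 : ℝ) < l := by exact_mod_cast hl
  have hlq : 0 < (l : ℝ) ^ q := Real.rpow_pos_of_pos hl0 q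
  -- The factor `c` absorbs the shift `j + 1`, and the factor `2` makes the inequality strict.
  have hj : 0 < (l : ℝ) ^ q / (2 * c) := by positivity
  have h := sum_div_pow_sq_le_div_sq J hj hc
  refine le_trans (Finset.sum_le_sum_of_subset_of_nonneg (fun j hj => ?_)
    fun _ _ _ => by positivity) (h.trans (le_of_eq ?_))
  · simp only [Finset.mem_filter] at hj ⊢
    refine ⟨hj.1, ?_⟩
    rw [div_lt_iff₀ (by positivity)]
    have h2 : (l : ℝ) ≤ 2 ^ (j + 1) := by exact_mod_cast hj.2
    have h3 : (l : ℝ) ^ q ≤ c ^ (j + 1) := by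
      calc (l : ℝ) ^ q ≤ ((2 : ℝ) ^ (j + 1)) ^ q := Real.rpow_le_rpow hl0.le h2 hq.le
        _ = c ^ (j + 1) := by
          rw [← Real.rpow_natCast, ← Real.rpow_mul zero_le_two, mul_comm,
            Real.rpow_mul zero_le_two, Real.rpow_natCast]
    have : 0 < c ^ (j + 1) := by positivity
    calc (l : ℝ) ^ q ≤ c ^ (j + 1) := h3
      _ < 2 * c ^ (j + 1) := by linarith
      _ = c ^ j * (2 * c) := by ring
  · field_simp

/-- A strong law of Rademacher–Menshov type. -/
theorem ae_tendsto_sum_div_rate {Z : ℕ → Ω → ℝ} (hZ : ∀ k, 1 ≤ k → MemLp (Z k) 2 P) {q : ℝ}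
    (hq : 0 < q) (hs : Summable fun l : ℕ => 1 / ((l : ℝ) ^ q) ^ 2 * rowMoment P Z l) :
    ∀ᵐ ω ∂P, Tendsto (fun n => (∑ k ∈ Finset.Ioc 0 n, Z k ω) / rate q n) atTop (𝓝 0) := by
  obtain ⟨C, hC, hCle⟩ := sum_inv_pow_sq_le hq
  set c : ℝ := 2 ^ q
  have hc : 0 < c := Real.rpow_pos_of_pos two_pos q
  set V : ℕ → ℝ := fun n => ∑ l ∈ Finset.Ioc 0 n, rowMoment P Z l
  have hsum : Summable fun m => 1 / (c ^ m) ^ 2 * V (2 ^ (m + 1)) := by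
    refine summable_mul_sum_Ioc (h := fun l => C / ((l : ℝ) ^ q) ^ 2) (rowMoment_nonneg Z)
      (fun j => by positivity) (fun l => by positivity) ?_ hCle
    refine (hs.mul_left C).congr fun l => by ring
  -- `D m` dominates the squares of all partial sums with `2 ^ m ≤ n < 2 ^ (m + 1)`. In its
  -- expectation one factor `m + 1` comes from Cauchy–Schwarz and another from the number of dyadic
  -- scales.
  set D : ℕ → Ω → ℝ := fun m ω => (m + 1) * ∑ i ∈ Finset.range (m + 1),
    ∑ a ∈ Finset.range (2 ^ (m + 1 - i)),
      (∑ k ∈ Finset.Ioc (a * 2 ^ i) ((a + 1) * 2 ^ i), Z k ω) ^ 2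
  have hsub : ∀ (f : ℕ → ℝ) (a d : ℕ), ∑ k ∈ Finset.Ioc 0 ((a + 1) * d), f k -
      ∑ k ∈ Finset.Ioc 0 (a * d), f k = ∑ k ∈ Finset.Ioc (a * d) ((a + 1) * d), f k := by
    intro f a d
    rw [← Finset.sum_Ioc_consecutive f (Nat.zero_le (a * d))
      (Nat.mul_le_mul_right d (Nat.le_succ a))]
    ring
  have hblock : ∀ m n, Integrable (fun ω => (∑ k ∈ Finset.Ioc m n, Z k ω) ^ 2) P :=
    fun m n => (memLp_sum_Ioc hZ m n).integrable_sq
  have hDint : ∀ m, Integrable (D m) P := fun m =>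
    (integrable_finsetSum _ fun i _ => integrable_finsetSum _ fun a _ => hblock _ _).const_mul _
  have hD0 : ∀ m ω, 0 ≤ D m ω := fun m ω => by positivity
  have hDle : ∀ m, ∫ ω, D m ω ∂P ≤ ((m : ℝ) + 1) ^ 2 * V (2 ^ (m + 1)) := by
    intro m
    simp only [D]
    rw [integral_const_mul, integral_finsetSum _ fun i _ =>
      integrable_finsetSum _ fun a _ => hblock _ _, sq, mul_assoc]
    refine mul_le_mul_of_nonneg_left ?_ (by positivity)
    have : ∀ i ∈ Finset.range (m + 1), ∫ ω, ∑ a ∈ Finset.range (2 ^ (m + 1 - i)),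
        (∑ k ∈ Finset.Ioc (a * 2 ^ i) ((a + 1) * 2 ^ i), Z k ω) ^ 2 ∂P ≤ V (2 ^ (m + 1)) := by
      intro i hi
      rw [integral_finsetSum _ fun a _ => hblock _ _]
      refine (Finset.sum_le_sum fun a _ => integral_block_sq_le hZ _ _).trans (le_of_eq ?_)
      simp_rw [← hsub]
      have := Finset.sum_range_sub (fun a => V (a * 2 ^ i)) (2 ^ (m + 1 - i))
      simp only [V] at this ⊢
      rw [this, ← pow_add, Nat.sub_add_cancel (Finset.mem_range.1 hi).le]
      simp
    refine (Finset.sum_le_sum this).trans (le_of_eq ?_)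
    simp
  -- The square of the logarithm in the normalisation cancels `(m + 1) ^ 2` exactly.
  have key := ae_tendsto_zero_of_summable_integral (P := P)
    (f := fun m ω => 1 / (c ^ m * ((m : ℝ) + 1)) ^ 2 * D m ω)
    (fun m => (hDint m).const_mul _) (fun m ω => mul_nonneg (by positivity) (hD0 m ω)) (by
      refine Summable.of_nonneg_of_le (fun m => integral_nonneg fun ω =>
        mul_nonneg (by positivity) (hD0 m ω)) (fun m => ?_) hsum
      rw [integral_const_mul]
      refine (mul_le_mul_of_nonneg_left (hDle m) (by positivity)).trans (le_of_eq ?_)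
      field_simp)
  filter_upwards [key] with ω hω
  have hω' := (hω.comp tendsto_natLog_two).const_mul 4
  rw [mul_zero] at hω'
  refine tendsto_zero_of_sq ?_
  refine squeeze_zero' (Eventually.of_forall fun n => sq_nonneg _) ?_ hω'
  filter_upwards [eventually_ge_atTop 1] with n hn
  have hn0 : n ≠ 0 := by omega
  set m := Nat.log 2 n
  have h1 : 2 ^ m ≤ n := Nat.pow_log_le_self 2 hn0
  have h2 : n < 2 ^ (m + 1) := Nat.lt_pow_succ_log_self one_lt_two n
  have hR := sq_sub_le_dyadic (fun n => ∑ k ∈ Finset.Ioc 0 n, Z k ω) m n h2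
  simp only [hsub] at hR
  simp only [Finset.Ioc_self, Finset.sum_empty, sub_zero] at hR
  have h1' : (2 : ℝ) ^ m ≤ n := by exact_mod_cast h1
  have hcm : c ^ m ≤ (n : ℝ) ^ q := by
    calc c ^ m = ((2 : ℝ) ^ m) ^ q := by
          rw [← Real.rpow_natCast, ← Real.rpow_natCast, ← Real.rpow_mul zero_le_two, mul_comm,
            Real.rpow_mul zero_le_two]
      _ ≤ (n : ℝ) ^ q := Real.rpow_le_rpow (by positivity) h1' hq.le
  have hlog : ((m : ℝ) + 1) / 2 ≤ 2 + Real.log n := by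
    have : Real.log ((2 : ℝ) ^ m) ≤ Real.log n := Real.log_le_log (by positivity) h1'
    rw [Real.log_pow] at this
    have h3 := Real.log_two_gt_d9
    have : (m : ℝ) * (1 / 2) ≤ m * Real.log 2 :=
      mul_le_mul_of_nonneg_left (by linarith) (by positivity)
    linarith
  have hrate : c ^ m * (((m : ℝ) + 1) / 2) ≤ rate q n :=
    mul_le_mul hcm hlog (by positivity) (by positivity)
  simp only [Function.comp_apply]
  rw [div_pow]
  calc (∑ k ∈ Finset.Ioc 0 n, Z k ω) ^ 2 / rate q n ^ 2
      ≤ D m ω / (c ^ m * (((m : ℝ) + 1) / 2)) ^ 2 := by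
        gcongr
    _ = 4 * (1 / (c ^ m * ((m : ℝ) + 1)) ^ 2 * D m ω) := by
        field_simp
        ring

end SecondMoment

/-! ### Deterministic estimates for power sums and truncations. -/

section Series

lemma sum_mul_le_of_antitone {w φ : ℕ → ℝ} {M : ℝ}
    (hw : ∀ n : ℕ, ∑ l ∈ Finset.Ioc 0 n, w l ≤ M * n)
    (hφ : ∀ l, 1 ≤ l → φ (l + 1) ≤ φ l) (hφ0 : ∀ l, 1 ≤ l → 0 ≤ φ l) (n : ℕ) :
    ∑ l ∈ Finset.Ioc 0 n, w l * φ l ≤ M * ∑ l ∈ Finset.Ioc 0 n, φ l := by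
  -- Abel summation by induction: the boundary term is carried along and dropped at the end, being
  -- nonnegative.
  have key : ∀ n : ℕ, ∑ l ∈ Finset.Ioc 0 n, w l * φ l ≤ M * ∑ l ∈ Finset.Ioc 0 n, φ l -
      (M * n - ∑ l ∈ Finset.Ioc 0 n, w l) * φ n := by
    intro n
    induction n with
    | zero => simp
    | succ n ih =>
      simp only [Finset.sum_Ioc_succ_top (Nat.zero_le n)]
      push_cast
      have h1 : (M * n - ∑ l ∈ Finset.Ioc 0 n, w l) * φ (n + 1) ≤
          (M * n - ∑ l ∈ Finset.Ioc 0 n, w l) * φ n := by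
        rcases Nat.eq_zero_or_pos n with rfl | hn
        · simp
        · exact mul_le_mul_of_nonneg_left (hφ n hn) (sub_nonneg.2 (hw n))
      linarith
  refine (key n).trans ?_
  rcases Nat.eq_zero_or_pos n with rfl | hn
  · simp
  · have := mul_nonneg (sub_nonneg.2 (hw n)) (hφ0 n hn)
    linarith

lemma summable_of_sum_Ioc_le {f : ℕ → ℝ} {c : ℝ} (hf : ∀ l, 0 ≤ f l)
    (h : ∀ n, ∑ l ∈ Finset.Ioc 0 n, f l ≤ c) : Summable f := by
  refine summable_of_sum_range_le (c := f 0 + c) hf fun n => ?_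
  have : ∑ l ∈ Finset.range (n + 1), f l = f 0 + ∑ l ∈ Finset.Ioc 0 n, f l := by
    induction n with
    | zero => simp
    | succ n ih => rw [Finset.sum_range_succ, ih, Finset.sum_Ioc_succ_top (Nat.zero_le n)]; ring
  rw [Finset.sum_range_succ] at this
  linarith [h n, hf n]

lemma one_sub_rpow_le {u p : ℝ} (hu : u ≤ 1) (hp0 : 0 ≤ p) (hp1 : p ≤ 1) :
    (1 - u) ^ p ≤ 1 - p * u := by
  have := rpow_one_add_le_one_add_mul_self (s := -u) (by linarith) hp0 hp1
  calc (1 - u) ^ p = (1 + -u) ^ p := by ring_nf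
    _ ≤ 1 + p * -u := this
    _ = 1 - p * u := by ring

/-- Bernoulli's inequality as a discrete derivative of `l ^ q`, to be telescoped. -/
lemma rpow_sub_one_le {q : ℝ} (hq0 : 0 < q) (hq1 : q ≤ 1) {l : ℕ} :
    ((l + 1 : ℕ) : ℝ) ^ (q - 1) ≤ (1 / q) * (((l + 1 : ℕ) : ℝ) ^ q - (l : ℝ) ^ q) := by
  have hl : (0 : ℝ) < ((l + 1 : ℕ) : ℝ) := by positivity
  set L : ℝ := ((l + 1 : ℕ) : ℝ)
  have e : (l : ℝ) = L * (1 - 1 / L) := by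
    rw [mul_sub, mul_one_div_cancel hl.ne']; simp [L]
  have hu : 1 / L ≤ 1 := by
    rw [div_le_one hl]; simp [L]
  have h1 := one_sub_rpow_le hu hq0.le hq1
  have h2 : (l : ℝ) ^ q ≤ L ^ q * (1 - q * (1 / L)) := by
    rw [e, Real.mul_rpow hl.le (by linarith)]
    exact mul_le_mul_of_nonneg_left h1 (Real.rpow_nonneg hl.le _)
  rw [Real.rpow_sub_one hl.ne']
  rw [one_div_mul_eq_div, le_div_iff₀ hq0]
  calc L ^ q / L * q = L ^ q - L ^ q * (1 - q * (1 / L)) := by field_simp; ring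
    _ ≤ _ := by linarith

lemma sum_rpow_sub_one_le {q : ℝ} (hq0 : 0 < q) (hq1 : q ≤ 1) (n : ℕ) :
    ∑ l ∈ Finset.Ioc 0 n, (l : ℝ) ^ (q - 1) ≤ (1 / q) * (n : ℝ) ^ q := by
  induction n with
  | zero => simp [Real.zero_rpow hq0.ne']
  | succ n ih =>
    rw [Finset.sum_Ioc_succ_top (Nat.zero_le n)]
    have := rpow_sub_one_le hq0 hq1 (l := n)
    linarith

/-- Telescoping bound for convergent power sums; the `2` pays for `l + 1 ≤ 2 * l`. -/
lemma rpow_neg_le_sub {p : ℝ} (hp0 : 0 < p) (hp1 : p ≤ 1) {l : ℕ} (hl : 1 ≤ l) :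
    (l : ℝ) ^ (-(1 + p)) ≤ (2 / p) * ((l : ℝ) ^ (-p) - ((l + 1 : ℕ) : ℝ) ^ (-p)) := by
  have hl1 : (1 : ℝ) ≤ l := by exact_mod_cast hl
  have hl0 : (0 : ℝ) < l := by linarith
  have hu : 1 / ((l : ℝ) + 1) ≤ 1 := by rw [div_le_one (by linarith)]; linarith
  have h1 := one_sub_rpow_le hu hp0.le hp1
  have e : ((l + 1 : ℕ) : ℝ) = l * (1 - 1 / ((l : ℝ) + 1))⁻¹ := by
    push_cast; field_simp; rw [add_sub_cancel_right, div_self hl0.ne']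
  have hpos : 0 < 1 - 1 / ((l : ℝ) + 1) := by
    rw [sub_pos, div_lt_one (by linarith)]; linarith
  have h2 : ((l + 1 : ℕ) : ℝ) ^ (-p) ≤ (l : ℝ) ^ (-p) * (1 - p * (1 / ((l : ℝ) + 1))) := by
    rw [e, Real.mul_rpow hl0.le (inv_nonneg.2 hpos.le), Real.inv_rpow hpos.le,
      Real.rpow_neg hpos.le, inv_inv]
    exact mul_le_mul_of_nonneg_left h1 (Real.rpow_nonneg hl0.le _)
  have h3 : (l : ℝ) ^ (-(1 + p)) = (l : ℝ) ^ (-p) / l := by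
    rw [← Real.rpow_sub_one hl0.ne']; ring_nf
  have hA : 0 < (l : ℝ) ^ (-p) := Real.rpow_pos_of_pos hl0 _
  rw [h3]
  have h4 : (l : ℝ) ^ (-p) * (p * (1 / ((l : ℝ) + 1))) ≤
      (l : ℝ) ^ (-p) - ((l + 1 : ℕ) : ℝ) ^ (-p) := by linarith
  calc (l : ℝ) ^ (-p) / l ≤ (2 / p) * ((l : ℝ) ^ (-p) * (p * (1 / ((l : ℝ) + 1)))) := by
        rw [div_le_iff₀ hl0]
        have : (2 / p) * ((l : ℝ) ^ (-p) * (p * (1 / ((l : ℝ) + 1)))) * l =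
          (l : ℝ) ^ (-p) * (2 * l / (l + 1)) := by field_simp
        rw [this]
        refine le_mul_of_one_le_right hA.le ?_
        rw [le_div_iff₀ (by linarith)]; linarith
    _ ≤ _ := mul_le_mul_of_nonneg_left h4 (by positivity)

lemma sum_rpow_neg_le {p : ℝ} (hp0 : 0 < p) (hp1 : p ≤ 1) (m n : ℕ) :
    ∑ l ∈ Finset.Ioc m n, (l : ℝ) ^ (-(1 + p)) ≤ (2 / p) * ((m + 1 : ℕ) : ℝ) ^ (-p) := by
  rcases le_total n m with h | h
  · rw [Finset.Ioc_eq_empty (by omega)]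
    simp only [Finset.sum_empty]
    positivity
  have key : ∑ l ∈ Finset.Ioc m n, (l : ℝ) ^ (-(1 + p)) ≤
      (2 / p) * (((m + 1 : ℕ) : ℝ) ^ (-p) - ((n + 1 : ℕ) : ℝ) ^ (-p)) := by
    induction n, h using Nat.le_induction with
    | base => simp
    | succ n hn ih =>
      rw [Finset.sum_Ioc_succ_top hn]
      have := rpow_neg_le_sub hp0 hp1 (l := n + 1) (by omega)
      linarith
  refine key.trans (mul_le_mul_of_nonneg_left ?_ (by positivity))
  have : 0 ≤ ((n + 1 : ℕ) : ℝ) ^ (-p) := by positivity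
  linarith

lemma abs_trunc {t : ℝ} (ht : 0 ≤ t) (x : ℝ) : |trunc t x| = min |x| t := by
  unfold trunc
  grind

/-- The sum is split at `l ≈ |x| ^ r`: earlier terms are at most `1`, later ones at most `x ^ 2 * l
^ (-2 / r)`, whose tail is again of order `|x| ^ r` because `r < 2`. -/
lemma trunc_sq_div_le {r : ℝ} (hr1 : 1 ≤ r) (hr2 : r < 2) (x : ℝ) (n : ℕ) :
    ∑ l ∈ Finset.Ioc 0 n, trunc ((l : ℝ) ^ (1 / r)) x ^ 2 / ((l : ℝ) ^ (1 / r)) ^ 2 ≤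
      (1 + 2 / (2 / r - 1)) * |x| ^ r := by
  have hr0 : 0 < r := by linarith
  have hp0 : 0 < 2 / r - 1 := by rw [sub_pos, lt_div_iff₀ hr0]; linarith
  have hp1 : 2 / r - 1 ≤ 1 := by
    rw [sub_le_iff_le_add, div_le_iff₀ hr0]; linarith
  set p := 2 / r - 1
  rcases eq_or_ne x 0 with rfl | hx
  · have : ∀ l : ℕ, trunc ((l : ℝ) ^ (1 / r)) 0 = 0 := fun l => by
      rw [← abs_eq_zero, abs_trunc (by positivity)]
      simp only [abs_zero]; exact min_eq_left (by positivity)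
    simp only [this]
    simp [Real.zero_rpow hr0.ne']
  have hx0 : 0 < |x| := abs_pos.2 hx
  set y := |x| ^ r
  have hy : 0 < y := Real.rpow_pos_of_pos hx0 r
  have b1 : ∀ l : ℕ, trunc ((l : ℝ) ^ (1 / r)) x ^ 2 / ((l : ℝ) ^ (1 / r)) ^ 2 ≤ 1 := by
    intro l
    refine div_le_one_of_le₀ ?_ (by positivity)
    rw [← sq_abs, abs_trunc (by positivity)]
    exact pow_le_pow_left₀ (by positivity) (min_le_right _ _) 2
  have b2 : ∀ l ∈ Finset.Ioc (Nat.floor y) n,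
      trunc ((l : ℝ) ^ (1 / r)) x ^ 2 / ((l : ℝ) ^ (1 / r)) ^ 2 ≤
      x ^ 2 * (l : ℝ) ^ (-(1 + p)) := by
    intro l hl
    have e : ((l : ℝ) ^ (1 / r)) ^ 2 = (l : ℝ) ^ (1 + p) := by
      rw [← Real.rpow_natCast, ← Real.rpow_mul (by positivity)]
      congr 1; simp only [p]; push_cast; ring
    rw [e, Real.rpow_neg (by positivity), ← div_eq_mul_inv]
    refine div_le_div_of_nonneg_right ?_ (by positivity)
    rw [← sq_abs, abs_trunc (by positivity), ← sq_abs x]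
    exact pow_le_pow_left₀ (by positivity) (min_le_left _ _) 2
  have hsplit : ∑ l ∈ Finset.Ioc 0 n,
      trunc ((l : ℝ) ^ (1 / r)) x ^ 2 / ((l : ℝ) ^ (1 / r)) ^ 2 ≤
      ∑ l ∈ Finset.Ioc 0 (Nat.floor y), (1 : ℝ) +
        ∑ l ∈ Finset.Ioc (Nat.floor y) n, x ^ 2 * (l : ℝ) ^ (-(1 + p)) := by
    refine le_trans ?_ (add_le_add (Finset.sum_le_sum fun l _ => b1 l)
      (Finset.sum_le_sum b2))
    rw [← Finset.sum_union (Finset.disjoint_left.2 fun l h1 h2 => by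
      rw [Finset.mem_Ioc] at h1 h2; omega)]
    refine Finset.sum_le_sum_of_subset_of_nonneg (fun l hl => ?_) fun _ _ _ => by positivity
    rw [Finset.mem_union]
    simp only [Finset.mem_Ioc] at hl ⊢
    omega
  refine hsplit.trans ?_
  rw [← Finset.mul_sum]
  have h1 : ∑ l ∈ Finset.Ioc 0 (Nat.floor y), (1 : ℝ) ≤ y := by
    simpa using Nat.floor_le hy.le
  have h2 := sum_rpow_neg_le hp0 hp1 (Nat.floor y) n
  have h3 : ((Nat.floor y + 1 : ℕ) : ℝ) ^ (-p) ≤ y ^ (-p) :=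
    Real.rpow_le_rpow_of_nonpos hy (by push_cast; exact (Nat.lt_floor_add_one y).le) (by linarith)
  have h4 : x ^ 2 * y ^ (-p) = y := by
    have : x ^ 2 = y ^ (2 / r) := by
      rw [← sq_abs]
      simp only [y]
      rw [← Real.rpow_mul hx0.le, mul_div_cancel₀ _ hr0.ne']
      norm_num
    rw [this, ← Real.rpow_add hy]
    simp [p]
  calc _ ≤ y + x ^ 2 * ((2 / p) * y ^ (-p)) := by
        refine add_le_add h1 (mul_le_mul_of_nonneg_left (h2.trans ?_) (sq_nonneg x))
        exact mul_le_mul_of_nonneg_left h3 (by positivity)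
    _ = y + (2 / p) * (x ^ 2 * y ^ (-p)) := by ring
    _ = (1 + 2 / p) * y := by rw [h4]; ring

lemma abs_sub_trunc_le {r τ : ℝ} (hr1 : 1 ≤ r) (hτ : 0 < τ) (x : ℝ) :
    |x - trunc τ x| ≤ |x| ^ r * τ ^ (1 - r) := by
  rcases le_or_gt |x| τ with h | h
  · have : trunc τ x = x := by
      unfold trunc; rw [abs_le] at h
      rw [min_eq_left h.2, max_eq_left h.1]
    rw [this, sub_self, abs_zero]; positivity
  · have h1 : |x - trunc τ x| ≤ |x| := by unfold trunc; grind
    refine h1.trans ?_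
    have hx : 0 < |x| := hτ.trans h
    have h2 : |x| ^ (1 - r) ≤ τ ^ (1 - r) :=
      Real.rpow_le_rpow_of_nonpos hτ h.le (by linarith)
    calc |x| = |x| ^ r * |x| ^ (1 - r) := by rw [← Real.rpow_add hx]; simp
      _ ≤ _ := mul_le_mul_of_nonneg_left h2 (by positivity)

end Series

/-! ### Truncated moments and Borel–Cantelli. -/

section Moments

variable {Ω : Type*} [MeasurableSpace Ω] {P : Measure Ω}

lemma integrable_abs_rpow {X : Ω → ℝ} {r : ℝ} (hr1 : 1 ≤ r)
    (hLr : MemLp X (ENNReal.ofReal r) P) : Integrable (fun ω => |X ω| ^ r) P := by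
  have h := hLr.integrable_norm_rpow (by simpa using by linarith) ENNReal.ofReal_ne_top
  rw [ENNReal.toReal_ofReal (by linarith)] at h
  simpa using h

variable [IsProbabilityMeasure P]

lemma integrable_of_memLp {X : Ω → ℝ} {r : ℝ} (hr1 : 1 ≤ r)
    (hLr : MemLp X (ENNReal.ofReal r) P) : Integrable X P :=
  hLr.integrable (by rw [← ENNReal.ofReal_one]; exact ENNReal.ofReal_le_ofReal hr1)

lemma continuous_trunc (t : ℝ) : Continuous (trunc t) := continuous_clamp _ _

lemma integrable_trunc_sq {X : Ω → ℝ} (hX : Measurable X) {t : ℝ} (ht : 0 ≤ t) :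
    Integrable (fun ω => trunc t (X ω) ^ 2) P :=
  (memLp_bounded_comp hX (continuous_trunc t)
    (fun x => abs_clamp_le le_rfl (by linarith) le_rfl x) 2).integrable_sq

/-- The normalised truncated moment decreases in `l`, so Abel summation replaces `a l ^ 2` by its
average bound `M`; `trunc_sq_div_le` then bounds the sum by `E|X| ^ r`. -/
lemma summable_truncated_moment {X : Ω → ℝ} (hX : Measurable X) {r M : ℝ} (hr1 : 1 ≤ r)
    (hr2 : r < 2) (hLr : MemLp X (ENNReal.ofReal r) P) {a : ℕ → ℝ}
    (ha : ∀ n : ℕ, ∑ l ∈ Finset.Ioc 0 n, a l ^ 2 ≤ M * n) :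
    Summable fun l : ℕ => 1 / ((l : ℝ) ^ (1 / r)) ^ 2 *
      (a l ^ 2 * ∫ ω, trunc ((l : ℝ) ^ (1 / r)) (X ω) ^ 2 ∂P) := by
  have hr0 : 0 < r := by linarith
  have hM : 0 ≤ M := by
    have := ha 1
    simp only [Nat.cast_one, mul_one] at this
    exact (Finset.sum_nonneg fun _ _ => sq_nonneg _).trans this
  set ψ : ℕ → ℝ → ℝ := fun l x =>
    trunc ((l : ℝ) ^ (1 / r)) x ^ 2 / ((l : ℝ) ^ (1 / r)) ^ 2 with hψ
  have hψi : ∀ l, Integrable (fun ω => ψ l (X ω)) P := fun l =>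
    (integrable_trunc_sq hX (by positivity)).div_const _
  have hψ0 : ∀ l x, 0 ≤ ψ l x := fun l x => by positivity
  have hψanti : ∀ l, 1 ≤ l → ∀ x, ψ (l + 1) x ≤ ψ l x := by
    intro l hl x
    have hl0 : (0 : ℝ) < l := by exact_mod_cast hl
    simp only [hψ]
    have ht : 0 < (l : ℝ) ^ (1 / r) := Real.rpow_pos_of_pos hl0 _
    have hst : (l : ℝ) ^ (1 / r) ≤ ((l + 1 : ℕ) : ℝ) ^ (1 / r) :=
      Real.rpow_le_rpow hl0.le (by push_cast; linarith) (by positivity)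
    set t := (l : ℝ) ^ (1 / r)
    set s := ((l + 1 : ℕ) : ℝ) ^ (1 / r)
    have hs : 0 < s := ht.trans_le hst
    rw [← sq_abs, ← sq_abs (trunc t x), ← div_pow, ← div_pow, abs_trunc ht.le, abs_trunc hs.le]
    refine pow_le_pow_left₀ (by positivity) ?_ 2
    rw [div_le_div_iff₀ hs ht, min_mul_of_nonneg _ _ ht.le, min_mul_of_nonneg _ _ hs.le]
    refine min_le_min (mul_le_mul_of_nonneg_left hst (abs_nonneg _)) (by linarith [mul_comm s t])
  have hint := integrable_abs_rpow hr1 hLr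
  have hsum : ∀ n, ∑ l ∈ Finset.Ioc 0 n, ∫ ω, ψ l (X ω) ∂P ≤
      (1 + 2 / (2 / r - 1)) * ∫ ω, |X ω| ^ r ∂P := by
    intro n
    rw [← integral_finsetSum _ fun l _ => hψi l, ← integral_const_mul]
    exact integral_mono (integrable_finsetSum _ fun l _ => hψi l) (hint.const_mul _)
      fun ω => trunc_sq_div_le hr1 hr2 (X ω) n
  have habel := sum_mul_le_of_antitone (φ := fun l => ∫ ω, ψ l (X ω) ∂P) ha
    (fun l hl => integral_mono (hψi _) (hψi _) fun ω => hψanti l hl _)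
    (fun l _ => integral_nonneg fun ω => hψ0 l _)
  have hmain : Summable fun l => a l ^ 2 * ∫ ω, ψ l (X ω) ∂P :=
    summable_of_sum_Ioc_le (fun l => mul_nonneg (sq_nonneg _) (integral_nonneg fun ω => hψ0 l _))
      fun n => (habel n).trans (mul_le_mul_of_nonneg_left (hsum n) hM)
  refine hmain.congr fun l => ?_
  simp only [hψ]
  rw [integral_div]
  ring

lemma ae_eventually_abs_le {X : ℕ → Ω → ℝ} {r : ℝ} (hr1 : 1 ≤ r)
    (hident : ∀ n, 1 ≤ n → IdentDistrib (X n) (X 1) P P)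
    (hLr : MemLp (X 1) (ENNReal.ofReal r) P) :
    ∀ᵐ ω ∂P, ∀ᶠ l : ℕ in atTop, |X l ω| ≤ (l : ℝ) ^ (1 / r) := by
  have hr0 : 0 < r := by linarith
  -- The tail-sum lemma used next is stated for the ambient `volume`.
  let _ : MeasureSpace Ω := ⟨P⟩
  have h := tsum_prob_mem_Ioi_lt_top (Ω := Ω) (X := fun ω => |X 1 ω| ^ r)
    (integrable_abs_rpow hr1 hLr) (fun ω => by positivity)
  set s : ℕ → Set Ω := fun l => {ω | 1 ≤ l ∧ (l : ℝ) ^ (1 / r) < |X l ω|} with hs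
  have hle : ∀ l, P (s l) ≤ P {ω | |X 1 ω| ^ r ∈ Set.Ioi (l : ℝ)} := by
    intro l
    rcases Nat.eq_zero_or_pos l with rfl | hl
    · simp [hs]
    have e1 : s l = X l ⁻¹' {x | (l : ℝ) ^ (1 / r) < |x|} := by ext ω; simp [hs]; intro; omega
    have hms : MeasurableSet {x : ℝ | (l : ℝ) ^ (1 / r) < |x|} :=
      measurableSet_lt measurable_const measurable_norm
    rw [e1, (hident l hl).measure_mem_eq hms]
    refine measure_mono fun ω hω => ?_
    have hω' : (l : ℝ) ^ (1 / r) < |X 1 ω| := hω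
    have := Real.rpow_lt_rpow (by positivity) hω' hr0
    rw [← Real.rpow_mul (by positivity), one_div_mul_cancel hr0.ne', Real.rpow_one] at this
    exact this
  have hfin : ∑' l, P (s l) ≠ ∞ := ((ENNReal.tsum_le_tsum hle).trans_lt h).ne
  filter_upwards [ae_eventually_notMem hfin] with ω hω
  filter_upwards [hω, eventually_ge_atTop 1] with l hl hl1
  by_contra hcon
  exact hl ⟨hl1, not_le.1 hcon⟩

end Moments

/-! ### From the integral hypothesis to summable second moments. -/

noncomputable section CovarianceSeries

variable {Ω : Type*} [MeasurableSpace Ω] {P : Measure Ω}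

/-- The centred clamped variable `b k * (clamp (ε k) - E clamp (ε k))`. -/
def centered (P : Measure Ω) (ε : ℕ → Ω → ℝ) (b lo hi : ℕ → ℝ) (k : ℕ) (ω : Ω) : ℝ :=
  b k * (clamp (lo k) (hi k) (ε k ω) - ∫ ω', clamp (lo k) (hi k) (ε k ω') ∂P)

lemma integral_centered_mul (ε : ℕ → Ω → ℝ) (b lo hi : ℕ → ℝ) (k l : ℕ) :
    ∫ ω, centered P ε b lo hi k ω * centered P ε b lo hi l ω ∂P =
      b k * b l * cov[fun ω => clamp (lo k) (hi k) (ε k ω),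
        fun ω => clamp (lo l) (hi l) (ε l ω); P] := by
  rw [covariance, ← integral_const_mul]
  refine integral_congr_ae (ae_of_all _ fun ω => ?_)
  simp only [centered]
  ring

variable [IsProbabilityMeasure P]

lemma memLp_clamp {X : Ω → ℝ} (hX : Measurable X) (a b : ℝ) (q : ℝ≥0∞) :
    MemLp (fun ω => clamp a b (X ω)) q P := by
  refine memLp_bounded_comp hX (continuous_clamp a b) (B := |a| + |b|) (fun x => ?_) q
  unfold clamp
  grind

lemma memLp_centered {ε : ℕ → Ω → ℝ} (hmeas : ∀ n, 1 ≤ n → Measurable (ε n)) (b lo hi : ℕ → ℝ) :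
    ∀ k, 1 ≤ k → MemLp (centered P ε b lo hi k) 2 P := fun k hk =>
  ((memLp_clamp (hmeas k hk) (lo k) (hi k) 2).sub (memLp_const _)).const_mul _

lemma PairwisePQD.pqd {ε : ℕ → Ω → ℝ} (hpqd : PairwisePQD P ε) {k l : ℕ} (hk : 1 ≤ k)
    (hl : 1 ≤ l) : PQD P (ε k) (ε l) := by
  rcases eq_or_ne k l with rfl | hne
  · exact PQD.self _
  · exact fun s t => sub_nonneg.1 (hpqd k l hk hl hne s t)

/-- A variable is PQD with itself, so variances of the clamped variables obey the same bound as
covariances. -/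
lemma rowMoment_centered_le {ε : ℕ → Ω → ℝ} (hmeas : ∀ n, 1 ≤ n → Measurable (ε n))
    (hident : ∀ n, 1 ≤ n → IdentDistrib (ε n) (ε 1) P P) (hpqd : PairwisePQD P ε)
    {a b lo hi : ℕ → ℝ} (hba : ∀ k, |b k| ≤ |a k|) {t : ℝ} {l : ℕ} (hl : 1 ≤ l)
    (h : ∀ k, 1 ≤ k → k ≤ l → -t ≤ lo k ∧ lo k ≤ hi k ∧ hi k ≤ t) :
    rowMoment P (centered P ε b lo hi) l ≤ a l ^ 2 * ∫ ω, trunc t (ε 1 ω) ^ 2 ∂P +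
      2 * ∑ k ∈ Finset.Ioo 0 l, |a k * a l| * truncCov P (ε k) (ε l) t := by
  have ht : 0 ≤ t := by have := h l hl le_rfl; linarith
  have hle : ∀ k, 1 ≤ k → k ≤ l → |∫ ω, centered P ε b lo hi k ω * centered P ε b lo hi l ω ∂P| ≤
      |a k * a l| * truncCov P (ε k) (ε l) t := by
    intro k hk hkl
    obtain ⟨h1, h2, h3⟩ := h k hk hkl
    obtain ⟨h1', h2', h3'⟩ := h l hl le_rfl
    rw [integral_centered_mul, abs_mul]
    refine mul_le_mul ?_ ((hpqd.pqd hk hl).covariance_clamp (hmeas k hk) (hmeas l hl)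
      h1 h2 h3 h1' h2' h3') (abs_nonneg _) (abs_nonneg _)
    rw [abs_mul, abs_mul]
    exact mul_le_mul (hba k) (hba l) (abs_nonneg _) (abs_nonneg _)
  refine add_le_add ?_ (mul_le_mul_of_nonneg_left (Finset.sum_le_sum fun k hk => ?_) zero_le_two)
  · have h1 := hle l hl le_rfl
    have e : ∫ ω, centered P ε b lo hi l ω ^ 2 ∂P =
        ∫ ω, centered P ε b lo hi l ω * centered P ε b lo hi l ω ∂P := by simp_rw [sq]
    rw [e]
    refine (le_abs_self _).trans (h1.trans ?_)
    rw [abs_mul_self, ← sq]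
    refine mul_le_mul_of_nonneg_left ?_ (sq_nonneg _)
    have hm : MemLp (fun ω => trunc t (ε l ω)) 2 P := memLp_clamp (hmeas l hl) (-t) t 2
    rw [truncCov, covariance_eq_sub hm hm]
    have hid : ∫ ω, trunc t (ε l ω) ^ 2 ∂P = ∫ ω, trunc t (ε 1 ω) ^ 2 ∂P :=
      ((hident l hl).comp ((continuous_trunc t).measurable.pow_const 2)).integral_eq
    rw [← hid]
    simp only [Pi.mul_apply, ← sq]
    linarith [sq_nonneg (∫ ω, trunc t (ε l ω) ∂P)]
  · rw [Finset.mem_Ioo] at hk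
    exact hle k hk.1 hk.2.le

lemma summable_rowMoment_centered {ε : ℕ → Ω → ℝ} (hmeas : ∀ n, 1 ≤ n → Measurable (ε n))
    (hident : ∀ n, 1 ≤ n → IdentDistrib (ε n) (ε 1) P P) (hpqd : PairwisePQD P ε)
    {a b lo hi t h : ℕ → ℝ} (hba : ∀ k, |b k| ≤ |a k|) (hh : ∀ l, 0 ≤ h l)
    (hlohi : ∀ k l, 1 ≤ k → k ≤ l → -t l ≤ lo k ∧ lo k ≤ hi k ∧ hi k ≤ t l)
    (hdiag : Summable fun l => h l * (a l ^ 2 * ∫ ω, trunc (t l) (ε 1 ω) ^ 2 ∂P))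
    (hcross : Summable fun l => h l * ∑ k ∈ Finset.Ioo 0 l,
      |a k * a l| * truncCov P (ε k) (ε l) (t l)) :
    Summable fun l => h l * rowMoment P (centered P ε b lo hi) l := by
  refine Summable.of_norm_bounded_eventually_nat (hdiag.add (hcross.mul_left 2)) ?_
  filter_upwards [eventually_ge_atTop 1] with l hl
  rw [Real.norm_of_nonneg (mul_nonneg (hh l) (rowMoment_nonneg _ _))]
  refine (mul_le_mul_of_nonneg_left (rowMoment_centered_le hmeas hident hpqd hba hl
    fun k hk hkl => hlohi k l hk hkl) (hh l)).trans (le_of_eq ?_)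
  ring

/-- As `G` is nondecreasing, the integral beyond `L l` is at least that over `(T l, 2 * T l]`, where
the integrand stays above a multiple of `h l * G (T l) / T l`. -/
lemma summable_of_weightedCovSum {ε : ℕ → Ω → ℝ} (hmeas : ∀ n, 1 ≤ n → Measurable (ε n))
    (hpqd : PairwisePQD P ε) {a L T h : ℕ → ℝ} {K : ℝ → ℝ} {C : ℝ} (hC : 0 < C)
    (hfin : weightedCovSum P ε a a L K < ∞) (hh : ∀ l, 0 ≤ h l)
    (hev : ∀ᶠ l in atTop, 0 < T l ∧ L l ≤ T l ∧
      ∀ s, T l < s → s ≤ 2 * T l → h l ≤ C * (K s * T l)) :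
    Summable fun l => h l * ∑ k ∈ Finset.Ioo 0 l,
      |a k * a l| * truncCov P (ε k) (ε l) (T l) := by
  set F : ℕ → ℕ → ℝ≥0∞ := fun k l => ENNReal.ofReal |a k * a l| *
    ∫⁻ s in Set.Ioi (L l), ENNReal.ofReal (K s * truncCov P (ε k) (ε l) s) with hF
  have hsum : ∑' l, ∑ k ∈ Finset.Ioo 0 l, F k l ≠ ∞ := by
    refine (lt_of_le_of_lt ?_ hfin).ne
    have e : weightedCovSum P ε a a L K =
        ∑' l, ∑' k, Set.indicator {q : ℕ × ℕ | 1 ≤ q.1 ∧ q.1 < q.2} (fun q => F q.1 q.2) (k, l) := by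
      rw [ENNReal.tsum_comm, ← ENNReal.tsum_prod (f := fun k l =>
        Set.indicator {q : ℕ × ℕ | 1 ≤ q.1 ∧ q.1 < q.2} (fun q => F q.1 q.2) (k, l))]
      exact tsum_subtype {q : ℕ × ℕ | 1 ≤ q.1 ∧ q.1 < q.2} fun q => F q.1 q.2
    rw [e]
    refine ENNReal.tsum_le_tsum fun l => ?_
    refine le_trans (Finset.sum_le_sum fun k hk => ?_) (ENNReal.sum_le_tsum (Finset.Ioo 0 l))
    rw [Finset.mem_Ioo] at hk
    rw [Set.indicator_of_mem (show (k, l) ∈ {q : ℕ × ℕ | 1 ≤ q.1 ∧ q.1 < q.2} from hk)]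
  have hfinl : ∀ l, ∑ k ∈ Finset.Ioo 0 l, F k l ≠ ∞ := ENNReal.ne_top_of_tsum_ne_top hsum
  have hS := (ENNReal.summable_toReal hsum).mul_left C
  refine Summable.of_norm_bounded_eventually_nat hS ?_
  filter_upwards [hev, eventually_ge_atTop 1] with l hl hl1
  obtain ⟨hT, hLT, hK⟩ := hl
  have hG : ∀ k ∈ Finset.Ioo 0 l, 0 ≤ truncCov P (ε k) (ε l) (T l) := fun k hk =>
    (hpqd.pqd (Finset.mem_Ioo.1 hk).1 hl1).truncCov_nonneg
      (hmeas k (Finset.mem_Ioo.1 hk).1) (hmeas l hl1) _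
  have hnn : 0 ≤ h l * ∑ k ∈ Finset.Ioo 0 l, |a k * a l| * truncCov P (ε k) (ε l) (T l) :=
    mul_nonneg (hh l) (Finset.sum_nonneg fun k hk => mul_nonneg (abs_nonneg _) (hG k hk))
  rw [Real.norm_of_nonneg hnn, ← ENNReal.ofReal_le_ofReal_iff (by positivity),
    ENNReal.ofReal_mul hC.le, ENNReal.ofReal_toReal (hfinl l), Finset.mul_sum, Finset.mul_sum,
    ENNReal.ofReal_sum_of_nonneg fun k hk =>
      mul_nonneg (hh l) (mul_nonneg (abs_nonneg _) (hG k hk))]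
  refine Finset.sum_le_sum fun k hk => ?_
  have hk1 : 1 ≤ k := (Finset.mem_Ioo.1 hk).1
  set G := truncCov P (ε k) (ε l) with hGdef
  -- `w` is the lower bound for `K s * G s` on `(T l, 2 * T l]`, an interval of length `T l`.
  set w := h l * G (T l) / (C * T l) with hw
  have hw0 : 0 ≤ w := div_nonneg (mul_nonneg (hh l) (hG k hk)) (by positivity)
  have hlow : ENNReal.ofReal w * ENNReal.ofReal (T l) ≤
      ∫⁻ s in Set.Ioi (L l), ENNReal.ofReal (K s * G s) := by
    calc ENNReal.ofReal w * ENNReal.ofReal (T l)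
        = ∫⁻ s in Set.Ioc (T l) (2 * T l), ENNReal.ofReal w := by
          rw [setLIntegral_const, Real.volume_Ioc]; congr 2; ring
      _ ≤ ∫⁻ s in Set.Ioc (T l) (2 * T l), ENNReal.ofReal (K s * G s) := by
          refine setLIntegral_mono' measurableSet_Ioc fun s hs => ENNReal.ofReal_le_ofReal ?_
          have hKs := hK s hs.1 hs.2
          have hmono : G (T l) ≤ G s :=
            (hpqd.pqd hk1 hl1).truncCov_mono (hmeas k hk1) (hmeas l hl1) hT.le hs.1.le
          have hK0 : 0 ≤ K s := by
            by_contra hcon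
            have h1 : K s * T l < 0 := mul_neg_of_neg_of_pos (not_le.1 hcon) hT
            have h2 := mul_neg_of_pos_of_neg hC h1
            linarith [hh l]
          rw [hw, div_le_iff₀ (by positivity)]
          calc h l * G (T l) ≤ C * (K s * T l) * G s :=
                mul_le_mul hKs hmono (hG k hk) (by positivity)
            _ = K s * G s * (C * T l) := by ring
      _ ≤ _ := lintegral_mono_set fun s hs => lt_of_le_of_lt hLT hs.1
  calc ENNReal.ofReal (h l * (|a k * a l| * G (T l)))
      = ENNReal.ofReal C * (ENNReal.ofReal |a k * a l| *
          (ENNReal.ofReal w * ENNReal.ofReal (T l))) := by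
        rw [← ENNReal.ofReal_mul hw0, ← ENNReal.ofReal_mul (abs_nonneg _),
          ← ENNReal.ofReal_mul hC.le]
        congr 1
        rw [hw]
        field_simp
    _ ≤ ENNReal.ofReal C * F k l := by
        gcongr
        exact mul_le_mul_right hlow _

end CovarianceSeries

/-! ### Deterministic limits of weighted averages. -/

section Deterministic

lemma sum_Ioc_zero_eq_range (f : ℕ → ℝ) (n : ℕ) :
    ∑ k ∈ Finset.Ioc 0 n, f k = ∑ k ∈ Finset.range n, f (k + 1) := by
  induction n with
  | zero => simp
  | succ n ih => rw [Finset.sum_Ioc_succ_top (Nat.zero_le n), ih, Finset.sum_range_succ]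

/-- Cauchy–Schwarz, followed by Cesàro means of `μ ^ 2`. -/
lemma tendsto_sum_mul_div {a μ : ℕ → ℝ} {M : ℝ}
    (ha : ∀ n : ℕ, ∑ l ∈ Finset.Ioc 0 n, a l ^ 2 ≤ M * n) (hμ : Tendsto μ atTop (𝓝 0)) :
    Tendsto (fun n : ℕ => (∑ k ∈ Finset.Ioc 0 n, a k * μ k) / n) atTop (𝓝 0) := by
  refine tendsto_zero_of_sq ?_
  have h1 : Tendsto (fun k => μ (k + 1) ^ 2) atTop (𝓝 0) := by
    have := ((tendsto_add_atTop_iff_nat 1).2 hμ).pow 2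
    simpa using this
  have h2 := h1.cesaro.const_mul M
  rw [mul_zero] at h2
  refine squeeze_zero' (Eventually.of_forall fun n => sq_nonneg _) ?_ h2
  filter_upwards [eventually_ge_atTop 1] with n hn
  have hn0 : (0 : ℝ) < n := by exact_mod_cast hn
  rw [← sum_Ioc_zero_eq_range (fun k => μ k ^ 2)]
  have hcs := Finset.sum_mul_sq_le_sq_mul_sq (Finset.Ioc 0 n) a μ
  rw [div_pow, div_le_iff₀ (by positivity)]
  calc (∑ k ∈ Finset.Ioc 0 n, a k * μ k) ^ 2
      ≤ (∑ k ∈ Finset.Ioc 0 n, a k ^ 2) * ∑ k ∈ Finset.Ioc 0 n, μ k ^ 2 := hcs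
    _ ≤ M * n * ∑ k ∈ Finset.Ioc 0 n, μ k ^ 2 :=
        mul_le_mul_of_nonneg_right (ha n) (Finset.sum_nonneg fun _ _ => sq_nonneg _)
    _ = M * ((n : ℝ)⁻¹ * ∑ k ∈ Finset.Ioc 0 n, μ k ^ 2) * (n : ℝ) ^ 2 := by field_simp

lemma tendsto_sum_div_of_eventually_eq {f g b : ℕ → ℝ} (hfg : ∀ᶠ k in atTop, f k = g k)
    (hb : Tendsto b atTop atTop)
    (hf : Tendsto (fun n => (∑ k ∈ Finset.Ioc 0 n, f k) / b n) atTop (𝓝 0)) :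
    Tendsto (fun n => (∑ k ∈ Finset.Ioc 0 n, g k) / b n) atTop (𝓝 0) := by
  obtain ⟨N, hN⟩ := eventually_atTop.1 hfg
  have h := hf.add ((tendsto_const_nhds
    (x := ∑ k ∈ Finset.Ioc 0 N, g k - ∑ k ∈ Finset.Ioc 0 N, f k)).div_atTop hb)
  rw [add_zero] at h
  refine h.congr' ?_
  filter_upwards [eventually_ge_atTop N] with n hn
  rw [← Finset.sum_Ioc_consecutive f (Nat.zero_le N) hn,
    ← Finset.sum_Ioc_consecutive g (Nat.zero_le N) hn,
    Finset.sum_congr rfl fun k hk => hN k (Finset.mem_Ioc.1 hk).1.le]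
  ring

/-- Etemadi's interpolation: for sums of nonnegative terms, convergence of the centred averages
along all geometric subsequences implies convergence. -/
lemma tendsto_sum_sub_div_of_floor_pow {a y e : ℕ → ℝ} {M E : ℝ}
    (ha : ∀ n : ℕ, ∑ l ∈ Finset.Ioc 0 n, a l ^ 2 ≤ M * n)
    (hy : ∀ k, 0 ≤ y k) (he0 : ∀ k, 0 ≤ e k) (he : ∀ k, 1 ≤ k → e k ≤ E * |a k|)
    (hsub : ∀ i : ℕ, Tendsto (fun j : ℕ =>
      (∑ k ∈ Finset.Ioc 0 ⌊(1 + 1 / ((i : ℝ) + 1)) ^ j⌋₊, (y k - e k)) /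
        (⌊(1 + 1 / ((i : ℝ) + 1)) ^ j⌋₊ : ℝ)) atTop (𝓝 0)) :
    Tendsto (fun n : ℕ => (∑ k ∈ Finset.Ioc 0 n, (y k - e k)) / n) atTop (𝓝 0) := by
  have hM : 0 ≤ M := by
    have := ha 1
    simp only [Nat.cast_one, mul_one] at this
    exact (Finset.sum_nonneg fun _ _ => sq_nonneg _).trans this
  set R : ℕ → ℝ := fun n => ∑ k ∈ Finset.Ioc 0 n, (y k - e k) with hR
  have hRsub : ∀ c d, c ≤ d → R d - R c = ∑ k ∈ Finset.Ioc c d, (y k - e k) := by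
    intro c d hcd
    simp only [hR]
    rw [← Finset.sum_Ioc_consecutive _ (Nat.zero_le c) hcd]; ring
  have hlow : ∀ c d, c ≤ d → -∑ k ∈ Finset.Ioc c d, e k ≤ R d - R c := by
    intro c d hcd
    rw [hRsub c d hcd, ← Finset.sum_neg_distrib]
    exact Finset.sum_le_sum fun k _ => by linarith [hy k]
  rw [Metric.tendsto_atTop]
  intro δ hδ
  -- The ratio `1 + κ` is taken so close to `1` that one geometric block of `e` contributes at most
  -- `δ / 4 * n`; the `+ 1` keeps the denominator positive.
  obtain ⟨i, hi⟩ := exists_nat_one_div_lt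
    (show 0 < (δ / 4) ^ 2 / (6 * M * E ^ 2 + 1) by positivity)
  set κ : ℝ := 1 / ((i : ℝ) + 1)
  have hκ0 : 0 < κ := by positivity
  have hκ1 : κ ≤ 1 := by
    rw [div_le_one (by positivity)]; linarith [(Nat.cast_nonneg i : (0 : ℝ) ≤ i)]
  have hκ : 6 * M * E ^ 2 * κ ≤ (δ / 4) ^ 2 := by
    rw [lt_div_iff₀ (by positivity)] at hi
    nlinarith
  set c : ℕ → ℕ := fun j => ⌊(1 + κ) ^ j⌋₊ with hc
  obtain ⟨J, hJ⟩ := Metric.tendsto_atTop.1 (hsub i) (δ / 4) (by positivity)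
  obtain ⟨N₁, hN₁⟩ := exists_nat_gt ((1 + κ) ^ (J + 1))
  obtain ⟨N₂, hN₂⟩ := exists_nat_gt (1 / κ)
  refine ⟨max (max N₁ N₂) 1, fun n hn => ?_⟩
  have hn1 : 1 ≤ n := le_trans (le_max_right _ _) hn
  have hnN₁ : N₁ ≤ n := (le_max_left _ _).trans ((le_max_left _ _).trans hn)
  have hnN₂ : N₂ ≤ n := (le_max_right _ _).trans ((le_max_left _ _).trans hn)
  have hn0 : (0 : ℝ) < n := by exact_mod_cast hn1
  have h1κ : 1 < 1 + κ := by linarith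
  obtain ⟨j, hj1, hj2⟩ := exists_nat_pow_near (by exact_mod_cast hn1 : (1 : ℝ) ≤ n) h1κ
  have hJj : J ≤ j := by
    by_contra hcon
    have h1 : (1 + κ) ^ (j + 1) ≤ (1 + κ) ^ (J + 1) :=
      pow_le_pow_right₀ h1κ.le (by omega)
    have h2 : (N₁ : ℝ) ≤ n := by exact_mod_cast hnN₁
    linarith
  have hκn : 1 ≤ κ * n := by
    have h2 : (N₂ : ℝ) ≤ n := by exact_mod_cast hnN₂
    rw [div_lt_iff₀ hκ0] at hN₂
    nlinarith
  have hcn : c j ≤ n := by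
    have := Nat.floor_le_floor hj1
    rwa [Nat.floor_natCast] at this
  have hnc : n ≤ c (j + 1) := Nat.le_floor hj2.le
  have hc1 : (c (j + 1) : ℝ) ≤ (1 + κ) * n := by
    refine (Nat.floor_le (by positivity)).trans ?_
    rw [pow_succ, mul_comm]
    exact mul_le_mul_of_nonneg_left hj1 (by positivity)
  have hc2 : (n : ℝ) * (1 - κ) - 1 ≤ c j := by
    have h1 : (1 + κ) ^ j - 1 ≤ c j := (Nat.sub_one_lt_floor _).le
    have h2 : (n : ℝ) ≤ (1 + κ) ^ j * (1 + κ) := by rw [← pow_succ]; exact hj2.le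
    have h3 : (n : ℝ) * (1 - κ) ≤ (1 + κ) ^ j := by
      calc (n : ℝ) * (1 - κ) ≤ (1 + κ) ^ j * (1 + κ) * (1 - κ) :=
            mul_le_mul_of_nonneg_right h2 (by linarith)
        _ = (1 + κ) ^ j * (1 - κ ^ 2) := by ring
        _ ≤ (1 + κ) ^ j := mul_le_of_le_one_right (by positivity) (by nlinarith)
    linarith
  have hbound : ∑ k ∈ Finset.Ioc (c j) (c (j + 1)), e k ≤ δ / 4 * n := by
    refine (abs_le_of_sq_le_sq' ?_ (by positivity)).2
    have h1 : ∑ k ∈ Finset.Ioc (c j) (c (j + 1)), e k ≤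
        E * ∑ k ∈ Finset.Ioc (c j) (c (j + 1)), |a k| := by
      rw [Finset.mul_sum]
      exact Finset.sum_le_sum fun k hk => he k (by have := Finset.mem_Ioc.1 hk; omega)
    -- The block has at most `2 * κ * n + 1 ≤ 3 * κ * n` indices, and `c (j + 1) ≤ 2 * n`.
    have h2 : (∑ k ∈ Finset.Ioc (c j) (c (j + 1)), |a k|) ^ 2 ≤
        (3 * κ * n) * (M * (2 * n)) := by
      refine sq_sum_le_card_mul_sum_sq.trans (mul_le_mul ?_ ?_
        (Finset.sum_nonneg fun _ _ => sq_nonneg _) (by positivity))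
      · rw [Nat.card_Ioc, Nat.cast_sub (hcn.trans hnc)]
        nlinarith
      · simp_rw [sq_abs]
        have h3 : ∑ k ∈ Finset.Ioc (c j) (c (j + 1)), a k ^ 2 ≤
            ∑ k ∈ Finset.Ioc 0 (c (j + 1)), a k ^ 2 :=
          Finset.sum_le_sum_of_subset_of_nonneg
            (Finset.Ioc_subset_Ioc_left (Nat.zero_le _)) fun _ _ _ => sq_nonneg _
        refine h3.trans ((ha _).trans (mul_le_mul_of_nonneg_left (hc1.trans ?_) hM))
        exact mul_le_mul_of_nonneg_right (by linarith) hn0.le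
    calc (∑ k ∈ Finset.Ioc (c j) (c (j + 1)), e k) ^ 2
        ≤ (E * ∑ k ∈ Finset.Ioc (c j) (c (j + 1)), |a k|) ^ 2 :=
          pow_le_pow_left₀ (Finset.sum_nonneg fun k _ => he0 k) h1 2
      _ = E ^ 2 * (∑ k ∈ Finset.Ioc (c j) (c (j + 1)), |a k|) ^ 2 := by ring
      _ ≤ E ^ 2 * ((3 * κ * n) * (M * (2 * n))) := mul_le_mul_of_nonneg_left h2 (sq_nonneg _)
      _ = 6 * M * E ^ 2 * κ * (n : ℝ) ^ 2 := by ring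
      _ ≤ (δ / 4) ^ 2 * (n : ℝ) ^ 2 := mul_le_mul_of_nonneg_right hκ (sq_nonneg _)
      _ = (δ / 4 * n) ^ 2 := by ring
  have hRc : ∀ j', J ≤ j' → |R (c j')| ≤ δ / 4 * c j' := by
    intro j' hj'
    have h1 := (hJ j' hj').le
    rw [Real.dist_eq, sub_zero, abs_div, Nat.abs_cast] at h1
    have h2 : (0 : ℝ) < c j' := by
      have : 1 ≤ c j' := Nat.le_floor (by simpa using one_le_pow₀ h1κ.le)
      exact_mod_cast this
    exact (div_le_iff₀ h2).1 h1
  have hsubset : ∀ m d, c j ≤ m → d ≤ c (j + 1) →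
      ∑ k ∈ Finset.Ioc m d, e k ≤ ∑ k ∈ Finset.Ioc (c j) (c (j + 1)), e k := fun m d hm hd =>
    Finset.sum_le_sum_of_subset_of_nonneg (Finset.Ioc_subset_Ioc hm hd) fun k _ _ => he0 k
  -- Since `y ≥ 0`, `R` falls by at most the sum of `e` over a block, so `R n` is trapped between
  -- its values at `c j` and `c (j + 1)`.
  have u1 := hlow n (c (j + 1)) hnc
  have u2 := hlow (c j) n hcn
  have u3 := hsubset n (c (j + 1)) hcn le_rfl
  have u4 := hsubset (c j) n le_rfl hnc
  have u5 := abs_le.1 (hRc (j + 1) (by omega))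
  have u6 := abs_le.1 (hRc j hJj)
  have hcn' : (c j : ℝ) ≤ n := by exact_mod_cast hcn
  have u7 : δ / 4 * c (j + 1) ≤ δ / 2 * n := by
    calc δ / 4 * c (j + 1) ≤ δ / 4 * ((1 + κ) * n) :=
          mul_le_mul_of_nonneg_left hc1 (by positivity)
      _ ≤ δ / 4 * (2 * n) := by gcongr; linarith
      _ = _ := by ring
  have u8 : δ / 4 * c j ≤ δ / 4 * n := mul_le_mul_of_nonneg_left hcn' (by positivity)
  rw [Real.dist_eq, sub_zero, abs_div, Nat.abs_cast, div_lt_iff₀ hn0, abs_lt]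
  have hδn : 0 < δ * n := by positivity
  constructor <;> linarith [u5.1, u5.2, u6.1, u6.2]

end Deterministic

/-! ### The strong law under a first moment. -/

section FirstMoment

variable {Ω : Type*} [MeasurableSpace Ω] {P : Measure Ω}

lemma abs_clamp_le_abs {a b : ℝ} (ha : a ≤ 0) (hb : 0 ≤ b) (x : ℝ) : |clamp a b x| ≤ |x| := by
  unfold clamp
  grind

lemma trunc_eq_self {t x : ℝ} (h : |x| ≤ t) : trunc t x = x := by
  rw [abs_le] at h
  unfold trunc
  rw [min_eq_left h.2, max_eq_left h.1]

lemma tendsto_integral_trunc {X : Ω → ℝ} (hX : Measurable X) (hint : Integrable X P) :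
    Tendsto (fun k : ℕ => ∫ ω, trunc k (X ω) ∂P) atTop (𝓝 (∫ ω, X ω ∂P)) := by
  refine tendsto_integral_of_dominated_convergence (fun ω => |X ω|)
    (fun k => ((continuous_trunc _).measurable.comp hX).aestronglyMeasurable) hint.abs
    (fun k => ae_of_all _ fun ω => ?_) (ae_of_all _ fun ω => ?_)
  · rw [Real.norm_eq_abs, abs_trunc (Nat.cast_nonneg k)]
    exact min_le_left _ _
  · refine tendsto_const_nhds.congr' ?_
    filter_upwards [eventually_ge_atTop ⌈|X ω|⌉₊] with k hk
    exact (trunc_eq_self ((Nat.le_ceil _).trans (by exact_mod_cast hk))).symm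

variable [IsProbabilityMeasure P]

/-- The sign condition `hpos` makes the uncentred sums monotone, which is what Etemadi's
interpolation uses; countably many ratios tending to `1` keep the exceptional set null. -/
lemma ae_tendsto_centered_div {ε : ℕ → Ω → ℝ} (hmeas : ∀ n, 1 ≤ n → Measurable (ε n))
    (hident : ∀ n, 1 ≤ n → IdentDistrib (ε n) (ε 1) P P) (hpqd : PairwisePQD P ε)
    (hint : Integrable (ε 1) P) {a b lo hi : ℕ → ℝ} {M : ℝ}
    (ha : ∀ n : ℕ, ∑ l ∈ Finset.Ioc 0 n, a l ^ 2 ≤ M * n) (hba : ∀ k, |b k| ≤ |a k|)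
    (hlo : ∀ k : ℕ, -(k : ℝ) ≤ lo k ∧ lo k ≤ 0) (hhi : ∀ k : ℕ, 0 ≤ hi k ∧ hi k ≤ k)
    (hpos : ∀ k x, 0 ≤ b k * clamp (lo k) (hi k) x)
    (hdiag : Summable fun l : ℕ => 1 / (l : ℝ) ^ 2 *
      (a l ^ 2 * ∫ ω, trunc (l : ℝ) (ε 1 ω) ^ 2 ∂P))
    (hcross : Summable fun l : ℕ => 1 / (l : ℝ) ^ 2 * ∑ k ∈ Finset.Ioo 0 l,
      |a k * a l| * truncCov P (ε k) (ε l) l) :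
    ∀ᵐ ω ∂P, Tendsto (fun n : ℕ => (∑ k ∈ Finset.Ioc 0 n, centered P ε b lo hi k ω) / n)
      atTop (𝓝 0) := by
  have hrow := summable_rowMoment_centered hmeas hident hpqd (lo := lo) (hi := hi)
    (t := fun l => (l : ℝ)) (h := fun l : ℕ => 1 / (l : ℝ) ^ 2) hba (fun l => by positivity)
    (fun k l _ hkl => by
      have : (k : ℝ) ≤ l := by exact_mod_cast hkl
      have := hlo k; have := hhi k
      refine ⟨?_, ?_, ?_⟩ <;> linarith) hdiag hcross
  have hsub : ∀ i : ℕ, ∀ᵐ ω ∂P, Tendsto (fun j : ℕ =>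
      (∑ k ∈ Finset.Ioc 0 ⌊(1 + 1 / ((i : ℝ) + 1)) ^ j⌋₊, centered P ε b lo hi k ω) /
        (⌊(1 + 1 / ((i : ℝ) + 1)) ^ j⌋₊ : ℝ)) atTop (𝓝 0) := by
    intro i
    have hκ : 0 < 1 / ((i : ℝ) + 1) := by positivity
    set c : ℝ := 1 + 1 / ((i : ℝ) + 1)
    have hc : 1 < c := by simp only [c]; linarith
    have hc0 : 0 < c - 1 := by linarith
    refine ae_tendsto_subseq (memLp_centered hmeas b lo hi)
      (h := fun l : ℕ => c ^ 5 * (c - 1)⁻¹ ^ 3 * 4 * (1 / (l : ℝ) ^ 2))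
      (fun l => by positivity) ?_ fun J l hl => ?_
    · refine (hrow.mul_left (c ^ 5 * (c - 1)⁻¹ ^ 3 * 4)).congr fun l => by ring
    · have hl0 : (0 : ℝ) < l := by exact_mod_cast hl
      -- Using `l / 2` turns `l ≤ ⌊c ^ j⌋` into a strict inequality and costs the factor `4`.
      have h := sum_div_nat_floor_pow_sq_le_div_sq J (half_pos hl0) hc
      refine le_trans (Finset.sum_le_sum_of_subset_of_nonneg (fun j hj => ?_)
        fun _ _ _ => by positivity) (h.trans (le_of_eq ?_))
      · simp only [Finset.mem_filter] at hj ⊢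
        refine ⟨hj.1, ?_⟩
        have : (l : ℝ) ≤ ⌊c ^ j⌋₊ := by exact_mod_cast hj.2
        linarith
      · field_simp
        ring
  filter_upwards [ae_all_iff.2 hsub] with ω hω
  have hmean : ∀ k, 1 ≤ k → |∫ ω, clamp (lo k) (hi k) (ε k ω) ∂P| ≤ ∫ ω, |ε 1 ω| ∂P := by
    intro k hk
    have e : ∫ ω, clamp (lo k) (hi k) (ε k ω) ∂P = ∫ ω, clamp (lo k) (hi k) (ε 1 ω) ∂P :=
      ((hident k hk).comp (continuous_clamp (lo k) (hi k)).measurable).integral_eq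
    rw [e]
    refine abs_integral_le_integral_abs.trans (integral_mono
      ((memLp_clamp (hmeas 1 le_rfl) _ _ 1).integrable le_rfl).abs hint.abs fun ω => ?_)
    exact abs_clamp_le_abs (hlo k).2 (hhi k).1 _
  have e : ∀ k, centered P ε b lo hi k ω = b k * clamp (lo k) (hi k) (ε k ω) -
      b k * ∫ ω', clamp (lo k) (hi k) (ε k ω') ∂P := fun k => mul_sub _ _ _
  simp only [e] at hω ⊢
  refine tendsto_sum_sub_div_of_floor_pow ha (E := ∫ ω, |ε 1 ω| ∂P)
    (fun k => hpos k _) (fun k => ?_) (fun k hk => ?_) hω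
  · rw [← integral_const_mul]
    exact integral_nonneg fun ω => hpos k _
  · refine (le_abs_self _).trans ?_
    rw [abs_mul, mul_comm]
    exact mul_le_mul (hmean k hk) (hba k) (abs_nonneg _) (integral_nonneg fun _ => abs_nonneg _)

/-- Strong law of large numbers for weighted sums under a first moment. -/
theorem ae_tendsto_weighted_sum_div {ε : ℕ → Ω → ℝ} (hmeas : ∀ n, 1 ≤ n → Measurable (ε n))
    (hident : ∀ n, 1 ≤ n → IdentDistrib (ε n) (ε 1) P P) (hpqd : PairwisePQD P ε)
    (hL1 : MemLp (ε 1) (ENNReal.ofReal 1) P) (hmean : ∫ ω, ε 1 ω ∂P = 0) {a : ℕ → ℝ} {M : ℝ}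
    (ha : ∀ n : ℕ, ∑ l ∈ Finset.Ioc 0 n, a l ^ 2 ≤ M * n)
    (hfin : weightedCovSum P ε a a (fun l => (l : ℝ)) (fun t => 1 / t ^ 3) < ∞) :
    ∀ᵐ ω ∂P, Tendsto (fun n : ℕ => (∑ k ∈ Finset.Ioc 0 n, a k * ε k ω) / n) atTop (𝓝 0) := by
  have hint := integrable_of_memLp le_rfl hL1
  have hdiag := summable_truncated_moment (hmeas 1 le_rfl) le_rfl one_lt_two hL1 ha
  simp only [div_one, Real.rpow_one] at hdiag
  have hcross := summable_of_weightedCovSum hmeas hpqd (T := fun l => (l : ℝ))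
    (h := fun l : ℕ => 1 / (l : ℝ) ^ 2) (C := 8) (by norm_num) hfin (fun l => by positivity) (by
      filter_upwards [eventually_ge_atTop 1] with l hl
      have hl0 : (0 : ℝ) < l := by exact_mod_cast hl
      refine ⟨hl0, le_rfl, fun s hs1 hs2 => ?_⟩
      have hs0 : 0 < s := hl0.trans hs1
      calc 1 / (l : ℝ) ^ 2 = 8 * (1 / (2 * (l : ℝ)) ^ 3 * l) := by field_simp; norm_num
        _ ≤ 8 * (1 / s ^ 3 * l) := by gcongr)
  have key : ∀ (b lo hi : ℕ → ℝ), (∀ k, |b k| ≤ |a k|) →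
      (∀ k : ℕ, -(k : ℝ) ≤ lo k ∧ lo k ≤ 0) → (∀ k : ℕ, 0 ≤ hi k ∧ hi k ≤ k) →
      (∀ k x, 0 ≤ b k * clamp (lo k) (hi k) x) → _ := fun b lo hi h1 h2 h3 h4 =>
    ae_tendsto_centered_div hmeas hident hpqd hint ha h1 h2 h3 h4 hdiag hcross
  have hc0 : ∀ (k : ℕ) (x : ℝ), 0 ≤ clamp 0 k x := fun k x => le_max_right _ _
  have hc1 : ∀ (k : ℕ) (x : ℝ), clamp (-(k : ℝ)) 0 x ≤ 0 := fun k x =>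
    max_le (min_le_right _ _) (by simp)
  have hp : ∀ k, |max (a k) 0| ≤ |a k| := fun k => by grind
  have hm : ∀ k, |max (-a k) 0| ≤ |a k| := fun k => by grind
  have hz : ∀ k : ℕ, -(k : ℝ) ≤ 0 ∧ (0 : ℝ) ≤ 0 := fun k => ⟨by simp, le_rfl⟩
  have hz' : ∀ k : ℕ, (0 : ℝ) ≤ 0 ∧ (0 : ℝ) ≤ k := fun k => ⟨le_rfl, by simp⟩
  have hk : ∀ k : ℕ, -(k : ℝ) ≤ -(k : ℝ) ∧ -(k : ℝ) ≤ 0 := fun k => ⟨le_rfl, by simp⟩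
  have hk' : ∀ k : ℕ, (0 : ℝ) ≤ (k : ℝ) ∧ (k : ℝ) ≤ k := fun k => ⟨by simp, le_rfl⟩
  -- Four products of constant sign: positive or negative part of the weight times positive or
  -- negative part of the truncated noise.
  have r1 := key (fun k => max (a k) 0) (fun _ => 0) (fun k => k) hp hz hk'
    fun k x => mul_nonneg (le_max_right _ _) (hc0 k x)
  have r2 := key (fun k => max (-a k) 0) (fun _ => 0) (fun k => k) hm hz hk'
    fun k x => mul_nonneg (le_max_right _ _) (hc0 k x)
  have r3 := key (fun k => -max (a k) 0) (fun k => -(k : ℝ)) (fun _ => 0)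
    (fun k => by rw [abs_neg]; exact hp k) hk hz'
    fun k x => mul_nonneg_of_nonpos_of_nonpos (neg_nonpos.2 (le_max_right _ _)) (hc1 k x)
  have r4 := key (fun k => -max (-a k) 0) (fun k => -(k : ℝ)) (fun _ => 0)
    (fun k => by rw [abs_neg]; exact hm k) hk hz'
    fun k x => mul_nonneg_of_nonpos_of_nonpos (neg_nonpos.2 (le_max_right _ _)) (hc1 k x)
  have hbc := ae_eventually_abs_le le_rfl hident hL1
  have hμ := tendsto_integral_trunc (hmeas 1 le_rfl) hint
  rw [hmean] at hμ
  -- The truncated means tend to `E ε 1 = 0`, so uncentring costs nothing in the limit.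
  have hmeans := tendsto_sum_mul_div ha hμ
  filter_upwards [r1, r2, r3, r4, hbc] with ω h1 h2 h3 h4 hω
  have hsum := (((h1.sub h2).sub h3).add h4).add hmeans
  simp only [sub_zero, add_zero] at hsum
  refine tendsto_sum_div_of_eventually_eq (f := fun k => a k * trunc k (ε k ω)) ?_
    tendsto_natCast_atTop_atTop (hsum.congr fun n => ?_)
  · filter_upwards [hω] with k hk
    rw [div_one, Real.rpow_one] at hk
    rw [trunc_eq_self hk]
  · rw [← sub_div, ← sub_div, ← add_div, ← add_div, ← Finset.sum_sub_distrib,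
      ← Finset.sum_sub_distrib, ← Finset.sum_add_distrib, ← Finset.sum_add_distrib]
    congr 1
    refine Finset.sum_congr rfl fun k hk => ?_
    have hk1 : 1 ≤ k := (Finset.mem_Ioc.1 hk).1
    have e1 : ∀ x, trunc (k : ℝ) x = clamp 0 k x + clamp (-(k : ℝ)) 0 x := by
      intro x
      have : (0 : ℝ) ≤ k := Nat.cast_nonneg k
      unfold trunc clamp
      grind
    have e2 : ∫ ω, trunc (k : ℝ) (ε 1 ω) ∂P =
        ∫ ω, clamp 0 k (ε k ω) ∂P + ∫ ω, clamp (-(k : ℝ)) 0 (ε k ω) ∂P := by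
      rw [← integral_add ((memLp_clamp (hmeas k hk1) _ _ 1).integrable le_rfl)
        ((memLp_clamp (hmeas k hk1) _ _ 1).integrable le_rfl)]
      simp_rw [← e1]
      exact ((hident k hk1).comp (continuous_trunc k).measurable).integral_eq.symm
    have e3 : a k = max (a k) 0 - max (-a k) 0 := by grind
    simp only [centered]
    rw [e2, e1]
    conv_rhs => rw [e3]
    conv_lhs => enter [2, 1]; rw [e3]
    ring

end FirstMoment

/-! ### Truncation levels, kernel bounds and the normalisation `rate`. -/

noncomputable section Levels

/-- The truncation level `l^{1/r} / (2 + log l)`. -/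
def cutoff (r : ℝ) (l : ℕ) : ℝ := (l : ℝ) ^ (1 / r) / (2 + Real.log l)

lemma cutoff_pos (r : ℝ) {l : ℕ} (hl : 1 ≤ l) : 0 < cutoff r l := by
  have : (0 : ℝ) < l := by exact_mod_cast hl
  exact div_pos (Real.rpow_pos_of_pos this _) (two_add_log_pos l)

lemma two_mul_cutoff_le (r : ℝ) (l : ℕ) : 2 * cutoff r l ≤ (l : ℝ) ^ (1 / r) := by
  have h := Real.log_natCast_nonneg l
  have h2 : 0 ≤ (l : ℝ) ^ (1 / r) := by positivity
  rw [cutoff, mul_div_assoc', div_le_iff₀ (two_add_log_pos l)]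
  nlinarith

lemma cutoff_le (r : ℝ) (l : ℕ) : cutoff r l ≤ (l : ℝ) ^ (1 / r) := by
  have h := two_mul_cutoff_le r l
  have h2 : 0 ≤ (l : ℝ) ^ (1 / r) := by positivity
  linarith

/-- The constant `2` in the denominator gives monotonicity from `l = 1` on: the derivative has the
sign of `(2 + log l) / r - 1`, and `r < 2`. -/
lemma cutoff_mono {r : ℝ} (hr0 : 0 < r) (hr2 : r < 2) {k l : ℕ} (hk : 1 ≤ k) (hkl : k ≤ l) :
    cutoff r k ≤ cutoff r l := by
  have hk0 : (0 : ℝ) < k := by exact_mod_cast hk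
  have hl0 : (0 : ℝ) < l := by exact_mod_cast hk.trans hkl
  have hlog : Real.log k ≤ Real.log l := Real.log_le_log hk0 (by exact_mod_cast hkl)
  have hq : 1 / 2 ≤ 1 / r := one_div_le_one_div_of_le hr0 hr2.le
  have hlogk := Real.log_natCast_nonneg k
  rw [cutoff, cutoff, div_le_div_iff₀ (two_add_log_pos k) (two_add_log_pos l)]
  set q := 1 / r
  have h1 : (l : ℝ) ^ q = (k : ℝ) ^ q * Real.exp (q * (Real.log l - Real.log k)) := by
    rw [Real.rpow_def_of_pos hl0, Real.rpow_def_of_pos hk0, ← Real.exp_add]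
    congr 1; ring
  have h2 := Real.add_one_le_exp (q * (Real.log l - Real.log k))
  rw [h1, mul_assoc]
  refine mul_le_mul_of_nonneg_left ?_ (by positivity)
  have h3 : (q * (Real.log l - Real.log k) + 1) * (2 + Real.log k) ≤
      Real.exp (q * (Real.log l - Real.log k)) * (2 + Real.log k) :=
    mul_le_mul_of_nonneg_right h2 (two_add_log_pos k).le
  have h4 : 0 ≤ (q - 1 / 2) * (Real.log l - Real.log k) :=
    mul_nonneg (by linarith) (by linarith)
  have h5 : 0 ≤ q * (Real.log l - Real.log k) * Real.log k :=
    mul_nonneg (mul_nonneg (by linarith) (by linarith)) hlogk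
  nlinarith

lemma Log_of_three_le {l : ℕ} (hl : 3 ≤ l) : Log l = Real.log l := by
  have h : (3 : ℝ) ≤ l := by exact_mod_cast hl
  rw [Log, Nat.abs_cast, max_eq_left]
  linarith [Real.exp_one_lt_d9]

lemma one_le_Log (x : ℝ) : 1 ≤ Log x := by
  have := Real.log_le_log (Real.exp_pos 1) (le_max_right |x| (Real.exp 1))
  rwa [Real.log_exp] at this

lemma Log_le {l : ℕ} (hl : 1 ≤ l) {x : ℝ} (hx0 : 0 ≤ x) (hx : x ≤ 2 * l) :
    Log x ≤ 2 + Real.log l := by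
  have hl1 : (1 : ℝ) ≤ l := by exact_mod_cast hl
  have he := Real.exp_one_gt_d9
  have h : max |x| (Real.exp 1) ≤ Real.exp 1 * l := by
    rw [abs_of_nonneg hx0]
    refine max_le (hx.trans (mul_le_mul_of_nonneg_right (by linarith) (by linarith))) ?_
    exact le_mul_of_one_le_right (Real.exp_pos 1).le hl1
  have h2 := Real.log_le_log (lt_max_of_lt_right (Real.exp_pos 1)) h
  rw [Real.log_mul (Real.exp_pos 1).ne' (by linarith), Real.log_exp] at h2
  rw [Log]
  linarith

/-- Only the first summand of `kernel` is kept; `8` is `2 ^ 3` from `s ≤ 2 * t`. At `t = l^{1/r}`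
the left side is `1 / rate ^ 2`, at `t = cutoff r l` it is `l^{-2/r}`. -/
lemma le_kernel_mul {l : ℕ} (hl : 1 ≤ l) {t s : ℝ} (ht : 0 < t) (htl : t ≤ l) (hs : t < s)
    (hs2 : s ≤ 2 * t) : 1 / (t * (2 + Real.log l)) ^ 2 ≤ 8 * (kernel s * t) := by
  have hs0 : 0 < s := ht.trans hs
  have hL := Log_le hl hs0.le (by linarith)
  have hL1 := one_le_Log s
  have hk : 1 / (s ^ 3 * Log s ^ 2) ≤ kernel s := by
    have : 0 ≤ 1 / (max s (Real.exp 1) * s ^ 2 * Log s ^ 3) := by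
      have : 0 < max s (Real.exp 1) := lt_max_of_lt_left hs0
      positivity
    rw [kernel]; linarith
  have hlog := two_add_log_pos l
  calc 1 / (t * (2 + Real.log l)) ^ 2
      = 8 * (1 / ((2 * t) ^ 3 * (2 + Real.log l) ^ 2) * t) := by field_simp; norm_num
    _ ≤ 8 * (1 / (s ^ 3 * Log s ^ 2) * t) := by gcongr
    _ ≤ 8 * (kernel s * t) := by gcongr

/-- Since `2 / r > 1`, the power `log^{2/r}` eventually beats any multiple of `2 + log`. -/
lemma eventually_level_le {r C : ℝ} (hr0 : 0 < r) (hr2 : r < 2) (hC : 0 < C) {u : ℕ → ℝ}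
    (hu : u =o[atTop] level r) : ∀ᶠ l in atTop, C * level r l + u l ≤ cutoff r l := by
  have hlog : Tendsto (fun l : ℕ => Real.log l) atTop atTop :=
    Real.tendsto_log_atTop.comp tendsto_natCast_atTop_atTop
  have hp : 0 < 2 / r - 1 := by rw [sub_pos, lt_div_iff₀ hr0]; linarith
  have hbig := ((tendsto_rpow_atTop hp).comp hlog).eventually_ge_atTop (6 * C)
  filter_upwards [hu.bound hC, hbig, eventually_ge_atTop 3, hlog.eventually_ge_atTop 1]
    with l h1 h2 h3 h4
  have hlev : 0 ≤ level r l := by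
    have := one_le_Log l
    rw [level]; positivity
  rw [Real.norm_eq_abs, Real.norm_of_nonneg hlev] at h1
  have h5 : C * level r l + u l ≤ 2 * C * level r l := by linarith [le_abs_self (u l)]
  refine h5.trans ?_
  rw [level, cutoff, Log_of_three_le h3]
  set y := Real.log l
  have hy : 0 < y := by linarith
  have hl : 0 ≤ (l : ℝ) ^ (1 / r) := by positivity
  have h6 : y ^ (2 / r) = y ^ (2 / r - 1) * y := by
    rw [Real.rpow_sub_one hy.ne']; field_simp
  simp only [Function.comp_apply] at h2
  rw [mul_div_assoc', div_le_div_iff₀ (by positivity) (by linarith), h6]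
  calc 2 * C * (l : ℝ) ^ (1 / r) * (2 + y) ≤ 2 * C * (l : ℝ) ^ (1 / r) * (3 * y) := by
        gcongr; linarith
    _ = (l : ℝ) ^ (1 / r) * (6 * C * y) := by ring
    _ ≤ (l : ℝ) ^ (1 / r) * (y ^ (2 / r - 1) * y) := by gcongr

/-- This sum bounds all truncation biases. It is `O(n^{1/r} (2 + log n)^{r-1})`, hence smaller than
`rate` by a factor `(2 + log n)^{r-2}`. -/
lemma tendsto_sum_cutoff_rpow {r M : ℝ} (hr1 : 1 < r) (hr2 : r < 2) {a : ℕ → ℝ}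
    (ha : ∀ n : ℕ, ∑ l ∈ Finset.Ioc 0 n, a l ^ 2 ≤ M * n) :
    Tendsto (fun n => (∑ k ∈ Finset.Ioc 0 n, |a k| * cutoff r k ^ (1 - r)) / rate (1 / r) n)
      atTop (𝓝 0) := by
  have hr0 : 0 < r := by linarith
  have hq0 : 0 < 1 / r := by positivity
  have hq1 : 1 / r ≤ 1 := by rw [div_le_one hr0]; exact hr1.le
  have hM : 0 ≤ M := by
    have := ha 1
    simp only [Nat.cast_one, mul_one] at this
    exact (Finset.sum_nonneg fun _ _ => sq_nonneg _).trans this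
  have habs : ∀ n : ℕ, ∑ l ∈ Finset.Ioc 0 n, |a l| ≤ (1 + M) * n := by
    intro n
    have : ∑ l ∈ Finset.Ioc 0 n, |a l| ≤ ∑ l ∈ Finset.Ioc 0 n, (1 + a l ^ 2) :=
      Finset.sum_le_sum fun l _ => by nlinarith [sq_abs (a l), sq_nonneg (|a l| - 1)]
    rw [Finset.sum_add_distrib] at this
    simp only [Finset.sum_const, Nat.card_Ioc, tsub_zero, nsmul_eq_mul, mul_one] at this
    linarith [ha n]
  have hsum : ∀ n : ℕ, ∑ l ∈ Finset.Ioc 0 n, |a l| * (l : ℝ) ^ (1 / r - 1) ≤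
      (1 + M) * (r * (n : ℝ) ^ (1 / r)) := by
    intro n
    refine (sum_mul_le_of_antitone (φ := fun l : ℕ => (l : ℝ) ^ (1 / r - 1)) habs
      (fun l hl => ?_) (fun l _ => by positivity) n).trans
      (mul_le_mul_of_nonneg_left ?_ (by linarith))
    · have : (0 : ℝ) < l := by exact_mod_cast hl
      exact Real.rpow_le_rpow_of_nonpos this (by push_cast; linarith) (by linarith)
    · simpa using sum_rpow_sub_one_le hq0 hq1 n
  have hlog : Tendsto (fun l : ℕ => 2 + Real.log l) atTop atTop :=
    tendsto_atTop_add_const_left _ _ (Real.tendsto_log_atTop.comp tendsto_natCast_atTop_atTop)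
  have hlim := ((tendsto_rpow_neg_atTop (show 0 < 2 - r by linarith)).comp hlog).const_mul
    ((1 + M) * r)
  rw [mul_zero] at hlim
  refine squeeze_zero' ?_ ?_ hlim
  · filter_upwards [eventually_ge_atTop 1] with n hn
    refine div_nonneg (Finset.sum_nonneg fun k hk => mul_nonneg (abs_nonneg _) ?_)
      (rate_pos hn).le
    exact Real.rpow_nonneg (cutoff_pos r (Finset.mem_Ioc.1 hk).1).le _
  · filter_upwards [eventually_ge_atTop 1] with n hn
    have hn0 : (0 : ℝ) < n := by exact_mod_cast hn
    have hL := two_add_log_pos n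
    set y := 2 + Real.log n
    have hterm : ∀ k ∈ Finset.Ioc 0 n, |a k| * cutoff r k ^ (1 - r) ≤
        y ^ (r - 1) * (|a k| * (k : ℝ) ^ (1 / r - 1)) := by
      intro k hk
      rw [Finset.mem_Ioc] at hk
      have hk0 : (0 : ℝ) < k := by exact_mod_cast hk.1
      have hlk : 2 + Real.log k ≤ y := by
        have := Real.log_le_log hk0 (by exact_mod_cast hk.2 : (k : ℝ) ≤ n)
        simp only [y]; linarith
      have e : cutoff r k ^ (1 - r) = (k : ℝ) ^ (1 / r - 1) * (2 + Real.log k) ^ (r - 1) := by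
        rw [cutoff, Real.div_rpow (by positivity) (two_add_log_pos k).le,
          ← Real.rpow_mul hk0.le, div_eq_mul_inv, ← Real.rpow_neg (two_add_log_pos k).le]
        congr 2
        · field_simp
        · ring
      rw [e]
      calc |a k| * ((k : ℝ) ^ (1 / r - 1) * (2 + Real.log k) ^ (r - 1))
          ≤ |a k| * ((k : ℝ) ^ (1 / r - 1) * y ^ (r - 1)) := by
            gcongr
        _ = _ := by ring
    rw [div_le_iff₀ (rate_pos hn)]
    refine (Finset.sum_le_sum hterm).trans ?_
    rw [← Finset.mul_sum]
    refine (mul_le_mul_of_nonneg_left (hsum n) (by positivity)).trans (le_of_eq ?_)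
    have e : y ^ (r - 1) = y ^ (-(2 - r)) * y := by
      rw [← Real.rpow_add_one hL.ne']; ring_nf
    simp only [Function.comp_apply, rate]
    rw [e]
    ring

lemma rate_two_pow (q : ℝ) (j : ℕ) :
    rate q (2 ^ j) = ((2 : ℝ) ^ q) ^ j * (2 + j * Real.log 2) := by
  rw [rate]
  push_cast
  rw [Real.log_pow, ← Real.rpow_natCast, ← Real.rpow_natCast, ← Real.rpow_mul zero_le_two,
    ← Real.rpow_mul zero_le_two, mul_comm q]

/-- On the range `l ≤ 2 ^ j` the logarithm is at least its value at `l`; what remains is a geometric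
tail. -/
lemma sum_inv_rate_sq_le {q : ℝ} (hq : 0 < q) :
    ∃ C : ℝ, 0 ≤ C ∧ ∀ J l : ℕ, 1 ≤ l →
      ∑ j ∈ Finset.range J with l ≤ 2 ^ j, 1 / rate q (2 ^ j) ^ 2 ≤ C * (1 / rate q l ^ 2) := by
  obtain ⟨C, hC, h⟩ := sum_inv_pow_sq_le hq
  refine ⟨C, hC, fun J l hl => ?_⟩
  have hl0 : (0 : ℝ) < l := by exact_mod_cast hl
  have hL := two_add_log_pos l
  have hterm : ∀ j ∈ (Finset.range J).filter (fun j => l ≤ 2 ^ j), 1 / rate q (2 ^ j) ^ 2 ≤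
      1 / (2 + Real.log l) ^ 2 * (1 / (((2 : ℝ) ^ q) ^ j) ^ 2) := by
    intro j hj
    have h2 : (l : ℝ) ≤ ((2 ^ j : ℕ) : ℝ) := by exact_mod_cast (Finset.mem_filter.1 hj).2
    have h3 := Real.log_le_log hl0 h2
    push_cast at h3
    rw [Real.log_pow] at h3
    have e : 1 / rate q (2 ^ j) ^ 2 =
        1 / (2 + j * Real.log 2) ^ 2 * (1 / (((2 : ℝ) ^ q) ^ j) ^ 2) := by
      rw [rate_two_pow, mul_pow, one_div_mul_one_div, mul_comm]
    rw [e]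
    gcongr
  refine (Finset.sum_le_sum hterm).trans ?_
  rw [← Finset.mul_sum]
  have hsub : ∑ j ∈ Finset.range J with l ≤ 2 ^ j, 1 / (((2 : ℝ) ^ q) ^ j) ^ 2 ≤
      C / ((l : ℝ) ^ q) ^ 2 := by
    refine le_trans (Finset.sum_le_sum_of_subset_of_nonneg (fun j hj => ?_)
      fun _ _ _ => by positivity) (h J l hl)
    simp only [Finset.mem_filter] at hj ⊢
    exact ⟨hj.1, hj.2.trans (Nat.pow_le_pow_right two_pos (Nat.le_succ j))⟩
  refine (mul_le_mul_of_nonneg_left hsub (by positivity)).trans (le_of_eq ?_)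
  rw [rate]
  field_simp

lemma rate_mono {q : ℝ} (hq : 0 ≤ q) {m n : ℕ} (hm : 1 ≤ m) (hmn : m ≤ n) :
    rate q m ≤ rate q n := by
  have hm0 : (0 : ℝ) < m := by exact_mod_cast hm
  have h : (m : ℝ) ≤ n := by exact_mod_cast hmn
  have h1 := Real.log_le_log hm0 h
  have h2 := two_add_log_pos m
  rw [rate, rate]
  gcongr

lemma rate_two_pow_succ_le {q : ℝ} (hq1 : q ≤ 1) (j : ℕ) :
    rate q (2 ^ (j + 1)) ≤ 4 * rate q (2 ^ j) := by
  rw [rate_two_pow, rate_two_pow, pow_succ]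
  have h2 : (2 : ℝ) ^ q ≤ 2 := by
    simpa using Real.rpow_le_rpow_of_exponent_le one_le_two hq1
  have h3 : 0 < Real.log 2 := Real.log_pos one_lt_two
  have h4 := Real.log_two_lt_d9
  have h5 : 0 ≤ (j : ℝ) * Real.log 2 := by positivity
  calc ((2 : ℝ) ^ q) ^ j * 2 ^ q * (2 + ((j + 1 : ℕ) : ℝ) * Real.log 2)
      ≤ ((2 : ℝ) ^ q) ^ j * 2 * (2 * (2 + j * Real.log 2)) := by
        gcongr
        push_cast
        linarith
    _ = _ := by ring

lemma tendsto_rate {q : ℝ} (hq : 0 < q) : Tendsto (rate q) atTop atTop := by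
  have h1 : Tendsto (fun n : ℕ => (n : ℝ) ^ q) atTop atTop :=
    (tendsto_rpow_atTop hq).comp tendsto_natCast_atTop_atTop
  refine tendsto_atTop_mono (fun n => ?_) h1
  rw [rate]
  exact le_mul_of_one_le_right (by positivity) (by linarith [Real.log_natCast_nonneg n])

/-- As the limit is zero, the bounded loss from doubling is harmless and ratios near `1` are not
needed. -/
lemma tendsto_div_rate_of_two_pow {q : ℝ} (hq0 : 0 ≤ q) (hq1 : q ≤ 1) {U : ℕ → ℝ}
    (hU : Monotone U) (hU0 : ∀ n, 0 ≤ U n)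
    (h : Tendsto (fun j => U (2 ^ j) / rate q (2 ^ j)) atTop (𝓝 0)) :
    Tendsto (fun n => U n / rate q n) atTop (𝓝 0) := by
  have h1 := ((h.comp (tendsto_add_atTop_nat 1)).comp tendsto_natLog_two).const_mul 4
  rw [mul_zero] at h1
  refine squeeze_zero' ?_ ?_ h1
  · filter_upwards [eventually_ge_atTop 1] with n hn
    exact div_nonneg (hU0 n) (rate_pos hn).le
  · filter_upwards [eventually_ge_atTop 1] with n hn
    have hn0 : n ≠ 0 := by omega
    simp only [Function.comp_apply]
    set m := Nat.log 2 n
    have h1 : 2 ^ m ≤ n := Nat.pow_log_le_self 2 hn0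
    have h2 : n < 2 ^ (m + 1) := Nat.lt_pow_succ_log_self one_lt_two n
    have h3 := rate_mono hq0 Nat.one_le_two_pow h1
    have h4 := rate_two_pow_succ_le hq1 m
    have h5 : 0 < rate q (2 ^ (m + 1)) := rate_pos Nat.one_le_two_pow
    rw [mul_div_assoc', div_le_div_iff₀ (rate_pos hn) h5]
    have h6 := hU h2.le
    calc U n * rate q (2 ^ (m + 1)) ≤ U (2 ^ (m + 1)) * (4 * rate q n) :=
          mul_le_mul h6 (by linarith) h5.le (hU0 _)
      _ = _ := by ring

end Levels

/-! ### The strong law under a moment of order between one and two. -/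

section HigherMoment

variable {Ω : Type*} [MeasurableSpace Ω] {P : Measure Ω} [IsProbabilityMeasure P]

/-- `κ k` is subtracted so that the terms become nonnegative excesses over the cutoff. Their centred
sums vanish along powers of two by second moments, their means by `tendsto_sum_cutoff_rpow`, and
monotonicity of the sums does the rest. -/
lemma ae_tendsto_sum_excess_div_rate {ε : ℕ → Ω → ℝ} (hmeas : ∀ n, 1 ≤ n → Measurable (ε n))
    (hident : ∀ n, 1 ≤ n → IdentDistrib (ε n) (ε 1) P P) (hpqd : PairwisePQD P ε) {r : ℝ}
    (hr1 : 1 < r) (hr2 : r < 2) (hLr : MemLp (ε 1) (ENNReal.ofReal r) P)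
    {a b lo hi κ : ℕ → ℝ} {M : ℝ}
    (ha : ∀ n : ℕ, ∑ l ∈ Finset.Ioc 0 n, a l ^ 2 ≤ M * n) (hba : ∀ k, |b k| ≤ |a k|)
    (hlohi : ∀ k l : ℕ, 1 ≤ k → k ≤ l → -(l : ℝ) ^ (1 / r) ≤ lo k ∧ lo k ≤ hi k ∧
      hi k ≤ (l : ℝ) ^ (1 / r))
    (hpos : ∀ k, 1 ≤ k → ∀ x, 0 ≤ b k * (clamp (lo k) (hi k) x - κ k))
    (hle : ∀ k, 1 ≤ k → ∀ x, b k * (clamp (lo k) (hi k) x - κ k) ≤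
      |a k| * |x - trunc (cutoff r k) x|)
    (hdiag : Summable fun l : ℕ => 1 / rate (1 / r) l ^ 2 *
      (a l ^ 2 * ∫ ω, trunc ((l : ℝ) ^ (1 / r)) (ε 1 ω) ^ 2 ∂P))
    (hcross : Summable fun l : ℕ => 1 / rate (1 / r) l ^ 2 * ∑ k ∈ Finset.Ioo 0 l,
      |a k * a l| * truncCov P (ε k) (ε l) ((l : ℝ) ^ (1 / r))) :
    ∀ᵐ ω ∂P, Tendsto (fun n : ℕ =>
      (∑ k ∈ Finset.Ioc 0 n, b k * (clamp (lo k) (hi k) (ε k ω) - κ k)) / rate (1 / r) n)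
      atTop (𝓝 0) := by
  have hr0 : 0 < r := by linarith
  have hq0 : 0 < 1 / r := by positivity
  have hq1 : 1 / r ≤ 1 := by rw [div_le_one hr0]; exact hr1.le
  obtain ⟨C, hC, hCle⟩ := sum_inv_rate_sq_le hq0
  have hrow := summable_rowMoment_centered hmeas hident hpqd (lo := lo) (hi := hi)
    (t := fun l : ℕ => (l : ℝ) ^ (1 / r)) (h := fun l : ℕ => 1 / rate (1 / r) l ^ 2) hba
    (fun l => by positivity) hlohi hdiag hcross
  have hsub := ae_tendsto_subseq (P := P) (memLp_centered hmeas b lo hi)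
    (h := fun l : ℕ => C * (1 / rate (1 / r) l ^ 2)) (b := fun j => rate (1 / r) (2 ^ j))
    (c := fun j => 2 ^ j) (fun l => by positivity)
    ((hrow.mul_left C).congr fun l => by ring) hCle
  -- The mean of the excess, which separates it from its centred version.
  set m : ℕ → ℝ := fun k => b k * (∫ ω, clamp (lo k) (hi k) (ε k ω) ∂P - κ k) with hm
  have hint : ∀ k, 1 ≤ k → Integrable (fun ω => clamp (lo k) (hi k) (ε k ω)) P := fun k hk =>
    (memLp_clamp (hmeas k hk) _ _ 1).integrable le_rfl
  have hm_eq : ∀ k, 1 ≤ k → m k = ∫ ω, b k * (clamp (lo k) (hi k) (ε k ω) - κ k) ∂P := by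
    intro k hk
    rw [integral_const_mul, integral_sub (hint k hk) (integrable_const _)]
    simp [hm]
  have hm0 : ∀ k, 1 ≤ k → 0 ≤ m k := fun k hk => by
    rw [hm_eq k hk]; exact integral_nonneg fun ω => hpos k hk _
  have hEr := integrable_abs_rpow hr1.le hLr
  set E : ℝ := ∫ ω, |ε 1 ω| ^ r ∂P
  have hmle : ∀ k, 1 ≤ k → m k ≤ E * (|a k| * cutoff r k ^ (1 - r)) := by
    intro k hk
    have hid : IdentDistrib (fun ω => |ε k ω| ^ r) (fun ω => |ε 1 ω| ^ r) P P :=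
      (hident k hk).comp (u := fun x : ℝ => |x| ^ r) (by fun_prop)
    have hik : Integrable (fun ω => |ε k ω| ^ r) P := hid.integrable_iff.2 hEr
    rw [hm_eq k hk]
    calc ∫ ω, b k * (clamp (lo k) (hi k) (ε k ω) - κ k) ∂P
        ≤ ∫ ω, |a k| * cutoff r k ^ (1 - r) * |ε k ω| ^ r ∂P := by
          refine integral_mono (((hint k hk).sub (integrable_const _)).const_mul _)
            (hik.const_mul _) fun ω => (hle k hk _).trans ?_
          rw [mul_assoc, mul_comm (cutoff r k ^ (1 - r))]
          exact mul_le_mul_of_nonneg_left (abs_sub_trunc_le hr1.le (cutoff_pos r hk) _)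
            (abs_nonneg _)
      _ = E * (|a k| * cutoff r k ^ (1 - r)) := by
          rw [integral_const_mul, hid.integral_eq, mul_comm]
  have hmlim : Tendsto (fun n => (∑ k ∈ Finset.Ioc 0 n, m k) / rate (1 / r) n) atTop (𝓝 0) := by
    have h := (tendsto_sum_cutoff_rpow hr1 hr2 ha).const_mul E
    rw [mul_zero] at h
    refine squeeze_zero' ?_ ?_ h
    · filter_upwards [eventually_ge_atTop 1] with n hn
      exact div_nonneg (Finset.sum_nonneg fun k hk => hm0 k (Finset.mem_Ioc.1 hk).1)
        (rate_pos hn).le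
    · filter_upwards [eventually_ge_atTop 1] with n hn
      rw [mul_div_assoc', Finset.mul_sum]
      exact div_le_div_of_nonneg_right
        (Finset.sum_le_sum fun k hk => hmle k (Finset.mem_Ioc.1 hk).1) (rate_pos hn).le
  have htwo : Tendsto (fun j : ℕ => 2 ^ j) atTop atTop :=
    tendsto_pow_atTop_atTop_of_one_lt one_lt_two
  filter_upwards [hsub] with ω hω
  refine tendsto_div_rate_of_two_pow hq0.le hq1
    (U := fun n => ∑ k ∈ Finset.Ioc 0 n, b k * (clamp (lo k) (hi k) (ε k ω) - κ k))
    (monotone_nat_of_le_succ fun n => ?_)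
    (fun n => Finset.sum_nonneg fun k hk => hpos k (Finset.mem_Ioc.1 hk).1 _) ?_
  · rw [Finset.sum_Ioc_succ_top (Nat.zero_le n)]
    exact le_add_of_nonneg_right (hpos _ (by omega) _)
  · have h := hω.add (hmlim.comp htwo)
    rw [add_zero] at h
    refine h.congr fun j => ?_
    simp only [Function.comp_apply]
    rw [← add_div, ← Finset.sum_add_distrib]
    congr 1
    refine Finset.sum_congr rfl fun k _ => ?_
    simp only [centered, hm]
    ring

/-- Strong law of large numbers for weighted sums under a moment of order `1 < r < 2`. -/
theorem ae_tendsto_weighted_sum_div_rate {ε : ℕ → Ω → ℝ}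
    (hmeas : ∀ n, 1 ≤ n → Measurable (ε n))
    (hident : ∀ n, 1 ≤ n → IdentDistrib (ε n) (ε 1) P P) (hpqd : PairwisePQD P ε) {r : ℝ}
    (hr1 : 1 < r) (hr2 : r < 2) (hLr : MemLp (ε 1) (ENNReal.ofReal r) P)
    (hmean : ∫ ω, ε 1 ω ∂P = 0) {a : ℕ → ℝ} {M : ℝ}
    (ha : ∀ n : ℕ, ∑ l ∈ Finset.Ioc 0 n, a l ^ 2 ≤ M * n) {C : ℝ} (hC : 0 < C) {u : ℕ → ℝ}
    (hu : u =o[atTop] level r)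
    (hfin : weightedCovSum P ε a a (fun l => C * level r l + u l) kernel < ∞) :
    ∀ᵐ ω ∂P, Tendsto (fun n : ℕ => (∑ k ∈ Finset.Ioc 0 n, a k * ε k ω) / rate (1 / r) n)
      atTop (𝓝 0) := by
  have hr0 : 0 < r := by linarith
  have hq0 : 0 < 1 / r := by positivity
  have hq1 : 1 / r ≤ 1 := by rw [div_le_one hr0]; exact hr1.le
  have hint := integrable_of_memLp hr1.le hLr
  have hlev := eventually_level_le hr0 hr2 hC hu
  have hTl : ∀ l : ℕ, 1 ≤ l → (l : ℝ) ^ (1 / r) ≤ l := fun l hl => by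
    have : (1 : ℝ) ≤ l := by exact_mod_cast hl
    simpa using Real.rpow_le_rpow_of_exponent_le this hq1
  have hTmono : ∀ k l : ℕ, k ≤ l → (k : ℝ) ^ (1 / r) ≤ (l : ℝ) ^ (1 / r) := fun k l hkl =>
    Real.rpow_le_rpow (by positivity) (by exact_mod_cast hkl) hq0.le
  have hrate : ∀ l : ℕ, 1 / rate (1 / r) l ^ 2 ≤ 1 / ((l : ℝ) ^ (1 / r)) ^ 2 := by
    intro l
    rcases Nat.eq_zero_or_pos l with rfl | hl
    · simp [rate, Real.zero_rpow (inv_pos.2 hr0).ne']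
    · have h0 : 0 < (l : ℝ) ^ (1 / r) := Real.rpow_pos_of_pos (by exact_mod_cast hl) _
      have h1 : (l : ℝ) ^ (1 / r) ≤ rate (1 / r) l :=
        le_mul_of_one_le_right h0.le (by linarith [Real.log_natCast_nonneg l])
      gcongr
  have hdiagT := summable_truncated_moment (hmeas 1 le_rfl) hr1.le hr2 hLr ha
  have hmom0 : ∀ (l : ℕ) (t : ℝ), 0 ≤ a l ^ 2 * ∫ ω, trunc t (ε 1 ω) ^ 2 ∂P := fun l t =>
    mul_nonneg (sq_nonneg _) (integral_nonneg fun ω => sq_nonneg _)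
  have hdiagR : Summable fun l : ℕ => 1 / rate (1 / r) l ^ 2 *
      (a l ^ 2 * ∫ ω, trunc ((l : ℝ) ^ (1 / r)) (ε 1 ω) ^ 2 ∂P) :=
    Summable.of_nonneg_of_le (fun l => mul_nonneg (by positivity) (hmom0 l _))
      (fun l => mul_le_mul_of_nonneg_right (hrate l) (hmom0 l _)) hdiagT
  have hdiagC : Summable fun l : ℕ => 1 / ((l : ℝ) ^ (1 / r)) ^ 2 *
      (a l ^ 2 * ∫ ω, trunc (cutoff r l) (ε 1 ω) ^ 2 ∂P) := by
    refine Summable.of_nonneg_of_le (fun l => mul_nonneg (by positivity) (hmom0 l _))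
      (fun l => ?_) hdiagT
    have hc0 : 0 ≤ cutoff r l := div_nonneg (by positivity) (two_add_log_pos l).le
    refine mul_le_mul_of_nonneg_left (mul_le_mul_of_nonneg_left (integral_mono
      (integrable_trunc_sq (hmeas 1 le_rfl) hc0)
      (integrable_trunc_sq (hmeas 1 le_rfl) (by positivity)) fun ω => ?_) (sq_nonneg _))
      (by positivity)
    simp only
    rw [← sq_abs, ← sq_abs (trunc ((l : ℝ) ^ (1 / r)) _), abs_trunc hc0,
      abs_trunc (by positivity)]
    exact pow_le_pow_left₀ (le_min (abs_nonneg _) hc0) (min_le_min le_rfl (cutoff_le r l)) 2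
  -- The integral hypothesis is read at two levels: here at `l^{1/r}` with weight `1 / rate ^ 2` for
  -- the excess, next at the cutoff with weight `l^{-2/r}` for the core.
  have hcrossR := summable_of_weightedCovSum hmeas hpqd (T := fun l : ℕ => (l : ℝ) ^ (1 / r))
    (h := fun l : ℕ => 1 / rate (1 / r) l ^ 2) (C := 8) (by norm_num) hfin
    (fun l => by positivity) (by
      filter_upwards [hlev, eventually_ge_atTop 1] with l h1 hl
      have h0 : 0 < (l : ℝ) ^ (1 / r) := Real.rpow_pos_of_pos (by exact_mod_cast hl) _
      exact ⟨h0, h1.trans (cutoff_le r l), fun s hs1 hs2 =>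
        le_kernel_mul hl h0 (hTl l hl) hs1 hs2⟩)
  have hcrossC := summable_of_weightedCovSum hmeas hpqd (T := cutoff r)
    (h := fun l : ℕ => 1 / ((l : ℝ) ^ (1 / r)) ^ 2) (C := 8) (by norm_num) hfin
    (fun l => by positivity) (by
      filter_upwards [hlev, eventually_ge_atTop 1] with l h1 hl
      refine ⟨cutoff_pos r hl, h1, fun s hs1 hs2 => ?_⟩
      have h := le_kernel_mul hl (cutoff_pos r hl) ((cutoff_le r l).trans (hTl l hl)) hs1 hs2
      rwa [cutoff, div_mul_cancel₀ _ (two_add_log_pos l).ne', ← cutoff] at h)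
  have hrow := summable_rowMoment_centered hmeas hident hpqd (b := a)
    (lo := fun k => -cutoff r k) (hi := cutoff r) (t := cutoff r)
    (h := fun l : ℕ => 1 / ((l : ℝ) ^ (1 / r)) ^ 2) (fun _ => le_rfl) (fun l => by positivity)
    (fun k l hk hkl => by
      have h1 := cutoff_mono hr0 hr2 hk hkl
      have h2 := cutoff_pos r hk
      refine ⟨?_, ?_, h1⟩ <;> linarith) hdiagC hcrossC
  have hA := ae_tendsto_sum_div_rate (memLp_centered hmeas a (fun k => -cutoff r k) (cutoff r))
    hq0 hrow
  have hB := ae_tendsto_sum_excess_div_rate hmeas hident hpqd hr1 hr2 hLr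
    (b := fun k => |a k|) (lo := cutoff r) (hi := fun k : ℕ => (k : ℝ) ^ (1 / r)) (κ := cutoff r)
    ha (fun k => (abs_abs _).le)
    (fun k l hk hkl => by
      have h1 := cutoff_pos r hk
      have h2 := hTmono k l hkl
      refine ⟨?_, cutoff_le r k, h2⟩
      have : 0 ≤ (l : ℝ) ^ (1 / r) := by positivity
      linarith)
    (fun k hk x => mul_nonneg (abs_nonneg _) (sub_nonneg.2 (le_max_right _ _)))
    (fun k hk x => mul_le_mul_of_nonneg_left (by
      have h1 := cutoff_pos r hk
      have h2 := cutoff_le r k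
      unfold clamp trunc
      grind) (abs_nonneg _)) hdiagR hcrossR
  -- The lower excess is nonpositive, so the weight `-|a k|` restores the sign.
  have hB' := ae_tendsto_sum_excess_div_rate hmeas hident hpqd hr1 hr2 hLr
    (b := fun k => -|a k|) (lo := fun k : ℕ => -(k : ℝ) ^ (1 / r)) (hi := fun k => -cutoff r k)
    (κ := fun k => -cutoff r k)
    ha (fun k => by rw [abs_neg, abs_abs])
    (fun k l hk hkl => by
      have h1 := cutoff_pos r hk
      have h2 := hTmono k l hkl
      have h3 := cutoff_le r k
      have : 0 ≤ (l : ℝ) ^ (1 / r) := by positivity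
      refine ⟨?_, ?_, ?_⟩ <;> linarith)
    (fun k hk x => mul_nonneg_of_nonpos_of_nonpos (neg_nonpos.2 (abs_nonneg _))
      (sub_nonpos.2 (max_le (min_le_right _ _) (by linarith [cutoff_le r k]))))
    (fun k hk x => by
      rw [neg_mul, ← mul_neg]
      refine mul_le_mul_of_nonneg_left ?_ (abs_nonneg _)
      have h1 := cutoff_pos r hk
      have h2 := cutoff_le r k
      unfold clamp trunc
      grind) hdiagR hcrossR
  have hEr := integrable_abs_rpow hr1.le hLr
  set E : ℝ := ∫ ω, |ε 1 ω| ^ r ∂P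
  -- Because `E ε 1 = 0`, the mean of the core is minus the mean of what truncation removes.
  have hμ : ∀ k, 1 ≤ k → |∫ ω, clamp (-cutoff r k) (cutoff r k) (ε k ω) ∂P| ≤
      cutoff r k ^ (1 - r) * E := by
    intro k hk
    have e : ∫ ω, clamp (-cutoff r k) (cutoff r k) (ε k ω) ∂P =
        ∫ ω, trunc (cutoff r k) (ε 1 ω) ∂P :=
      ((hident k hk).comp (continuous_trunc (cutoff r k)).measurable).integral_eq
    have hti : Integrable (fun ω => trunc (cutoff r k) (ε 1 ω)) P :=
      (memLp_clamp (hmeas 1 le_rfl) _ _ 1).integrable le_rfl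
    have e2 : ∫ ω, trunc (cutoff r k) (ε 1 ω) ∂P =
        -∫ ω, (ε 1 ω - trunc (cutoff r k) (ε 1 ω)) ∂P := by
      rw [integral_sub hint hti, hmean]; ring
    rw [e, e2, abs_neg, ← integral_const_mul]
    refine abs_integral_le_integral_abs.trans (integral_mono (hint.sub hti).abs
      (hEr.const_mul _) fun ω => ?_)
    simp only
    rw [mul_comm]
    exact abs_sub_trunc_le hr1.le (cutoff_pos r hk) _
  have hS := (tendsto_sum_cutoff_rpow hr1 hr2 ha).const_mul E
  rw [mul_zero] at hS
  filter_upwards [hA, hB, hB', ae_eventually_abs_le hr1.le hident hLr] with ω h1 h2 h3 hω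
  have hsum := ((h1.abs.add hS).add h2).add h3
  simp only [abs_zero, add_zero] at hsum
  refine tendsto_sum_div_of_eventually_eq (f := fun k => a k * trunc ((k : ℝ) ^ (1 / r)) (ε k ω))
    ?_ (tendsto_rate hq0) ?_
  · filter_upwards [hω] with k hk
    rw [trunc_eq_self hk]
  · rw [tendsto_zero_iff_abs_tendsto_zero]
    refine squeeze_zero' (Eventually.of_forall fun n => abs_nonneg _) ?_ hsum
    filter_upwards [eventually_ge_atTop 1] with n hn
    have hR := rate_pos (q := 1 / r) hn
    simp only [Function.comp_apply]
    rw [abs_div, abs_div, abs_of_pos hR, mul_div_assoc', ← add_div, ← add_div, ← add_div]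
    refine div_le_div_of_nonneg_right ?_ hR.le
    have hsplit : ∑ k ∈ Finset.Ioc 0 n, a k * trunc ((k : ℝ) ^ (1 / r)) (ε k ω) =
        ∑ k ∈ Finset.Ioc 0 n, centered P ε a (fun k => -cutoff r k) (cutoff r) k ω +
        ∑ k ∈ Finset.Ioc 0 n, a k * (∫ ω', clamp (-cutoff r k) (cutoff r k) (ε k ω') ∂P +
          (clamp (cutoff r k) ((k : ℝ) ^ (1 / r)) (ε k ω) - cutoff r k) +
          (clamp (-(k : ℝ) ^ (1 / r)) (-cutoff r k) (ε k ω) - -cutoff r k)) := by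
      rw [← Finset.sum_add_distrib]
      refine Finset.sum_congr rfl fun k hk => ?_
      have e : ∀ x, trunc ((k : ℝ) ^ (1 / r)) x = clamp (-cutoff r k) (cutoff r k) x +
          (clamp (cutoff r k) ((k : ℝ) ^ (1 / r)) x - cutoff r k) +
          (clamp (-(k : ℝ) ^ (1 / r)) (-cutoff r k) x - -cutoff r k) := by
        intro x
        have h1 := cutoff_pos r (Finset.mem_Ioc.1 hk).1
        have h2 := cutoff_le r k
        unfold clamp trunc
        grind
      rw [e, centered]
      ring
    rw [hsplit, add_assoc, add_assoc]
    refine (abs_add_le _ _).trans (add_le_add le_rfl ?_)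
    refine (Finset.abs_sum_le_sum_abs _ _).trans ?_
    rw [Finset.mul_sum, ← Finset.sum_add_distrib, ← Finset.sum_add_distrib]
    refine Finset.sum_le_sum fun k hk => ?_
    have hk1 := (Finset.mem_Ioc.1 hk).1
    have w1 : 0 ≤ clamp (cutoff r k) ((k : ℝ) ^ (1 / r)) (ε k ω) - cutoff r k :=
      sub_nonneg.2 (le_max_right _ _)
    have w2 : clamp (-(k : ℝ) ^ (1 / r)) (-cutoff r k) (ε k ω) - -cutoff r k ≤ 0 :=
      sub_nonpos.2 (max_le (min_le_right _ _) (by linarith [cutoff_le r k]))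
    rw [abs_mul]
    have w3 := hμ k hk1
    calc _ ≤ |a k| * (cutoff r k ^ (1 - r) * E +
          (clamp (cutoff r k) ((k : ℝ) ^ (1 / r)) (ε k ω) - cutoff r k) +
          -(clamp (-(k : ℝ) ^ (1 / r)) (-cutoff r k) (ε k ω) - -cutoff r k)) := by
          refine mul_le_mul_of_nonneg_left ?_ (abs_nonneg _)
          refine (abs_add_le _ _).trans (add_le_add ((abs_add_le _ _).trans ?_) ?_)
          · rw [abs_of_nonneg w1]
            exact add_le_add w3 le_rfl
          · rw [abs_of_nonpos w2]
      _ = _ := by ring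

end HigherMoment

/-! ### Linear algebra of the least-squares estimator. -/

section LeastSquares

variable {p : ℕ}

/-- The Gram matrix and the design have the same kernel, and adding rows can only shrink it. -/
lemma isUnit_gram_mono {x : ℕ → Fin p → ℝ} {m n : ℕ} (hmn : m ≤ n)
    (h : IsUnit ((design x m)ᵀ * design x m)) : IsUnit ((design x n)ᵀ * design x n) := by
  have hker : ∀ (k : ℕ) (v : Fin p → ℝ),
      ((design x k)ᵀ * design x k) *ᵥ v = 0 ↔ design x k *ᵥ v = 0 := fun k v => by
    rw [← Matrix.conjTranspose_eq_transpose_of_trivial]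
    exact Matrix.conjTranspose_mul_self_mulVec_eq_zero (design x k) v
  rw [← Matrix.mulVec_injective_iff_isUnit] at h ⊢
  rw [← Matrix.coe_mulVecLin, injective_iff_map_eq_zero] at h ⊢
  intro v hv
  refine h v ?_
  rw [Matrix.mulVecLin_apply, hker] at hv ⊢
  ext i
  exact congrFun hv (Fin.castLE hmn i)

/-- The quadratic form of the positive semidefinite inverse is tested on `e_i ± e_j`. A singular
Gram matrix has inverse `0` by convention, so invertibility is not needed. -/
lemma abs_gram_inv_le (x : ℕ → Fin p → ℝ) (n : ℕ) (i j : Fin p) :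
    |((design x n)ᵀ * design x n)⁻¹ i j| ≤
      (((design x n)ᵀ * design x n)⁻¹ i i + ((design x n)ᵀ * design x n)⁻¹ j j) / 2 := by
  have hB : (((design x n)ᵀ * design x n)⁻¹).PosSemidef := by
    rw [← Matrix.conjTranspose_eq_transpose_of_trivial]
    exact (Matrix.posSemidef_conjTranspose_mul_self (design x n)).inv
  set B := ((design x n)ᵀ * design x n)⁻¹
  have hsymm : B j i = B i j := by simpa using hB.isHermitian.apply i j
  have h1 := hB.dotProduct_mulVec_nonneg (Pi.single i 1 + Pi.single j 1)
  have h2 := hB.dotProduct_mulVec_nonneg (Pi.single i 1 - Pi.single j 1)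
  simp only [star_trivial, Matrix.mulVec_add, Matrix.mulVec_sub, Matrix.mulVec_single_one,
    add_dotProduct, sub_dotProduct, dotProduct_add, dotProduct_sub, single_one_dotProduct,
    Matrix.col_apply, hsymm] at h1 h2
  rw [abs_le]
  constructor <;> linarith

lemma lsEstimate_eq {x : ℕ → Fin p → ℝ} {β : Fin p → ℝ} {y e : ℕ → ℝ} {n : ℕ}
    (hy : ∀ i, 1 ≤ i → y i = ∑ j, x i j * β j + e i)
    (h : IsUnit ((design x n)ᵀ * design x n)) :
    lsEstimate (design x n) (obs y n) =
      β + ((design x n)ᵀ * design x n)⁻¹ *ᵥ fun i => ∑ k ∈ Finset.Ioc 0 n, x k i * e k := by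
  have h1 : obs y n = design x n *ᵥ β + obs e n := by
    ext i
    simp [obs, design, Matrix.mulVec, dotProduct, hy (i + 1) (by omega)]
  have h2 : (design x n)ᵀ *ᵥ obs e n = fun i => ∑ k ∈ Finset.Ioc 0 n, x k i * e k := by
    ext i
    rw [sum_Ioc_zero_eq_range, ← Fin.sum_univ_eq_sum_range (fun k => x (k + 1) i * e (k + 1))]
    simp [obs, design, Matrix.mulVec, dotProduct]
  rw [lsEstimate, h1, Matrix.mulVec_add, Matrix.mulVec_add, h2, Matrix.mulVec_mulVec,
    Matrix.mulVec_mulVec, Matrix.mul_assoc, Matrix.nonsing_inv_mul _ ((Matrix.isUnit_iff_isUnit_det _).1 h),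
    Matrix.one_mulVec]

/-- Every entry of the inverse is `O(1 / b n)` while the noise is `o(b n)`, so the error tends to
zero. -/
lemma tendsto_lsEstimate {x : ℕ → Fin p → ℝ} {β : Fin p → ℝ} {y e b : ℕ → ℝ}
    (hy : ∀ i, 1 ≤ i → y i = ∑ j, x i j * β j + e i)
    (hnonsing : ∃ n, IsUnit ((design x n)ᵀ * design x n)) (hb : ∀ n, 1 ≤ n → 0 < b n)
    (hinv : ∀ j, (fun n : ℕ => ((design x n)ᵀ * design x n)⁻¹ j j) =O[atTop] fun n => 1 / b n)
    (hnoise : ∀ i, Tendsto (fun n => (∑ k ∈ Finset.Ioc 0 n, x k i * e k) / b n) atTop (𝓝 0)) :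
    Tendsto (fun n => lsEstimate (design x n) (obs y n)) atTop (𝓝 β) := by
  obtain ⟨m, hm⟩ := hnonsing
  have hlim : Tendsto (fun n => β + ((design x n)ᵀ * design x n)⁻¹ *ᵥ
      fun i => ∑ k ∈ Finset.Ioc 0 n, x k i * e k) atTop (𝓝 (β + 0)) := by
    refine tendsto_const_nhds.add (tendsto_pi_nhds.2 fun j => ?_)
    have hterm : ∀ i, Tendsto (fun n => ((design x n)ᵀ * design x n)⁻¹ j i *
        ∑ k ∈ Finset.Ioc 0 n, x k i * e k) atTop (𝓝 0) := by
      intro i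
      have hO : (fun n : ℕ => ((design x n)ᵀ * design x n)⁻¹ j i) =O[atTop] fun n => 1 / b n := by
        refine IsBigO.trans (IsBigO.of_bound 1 (Eventually.of_forall fun n => ?_))
          ((hinv j).add (hinv i))
        rw [one_mul, Real.norm_eq_abs, Real.norm_eq_abs]
        have h1 := abs_gram_inv_le x n j i
        have h2 : 0 ≤ |((design x n)ᵀ * design x n)⁻¹ j i| := abs_nonneg _
        exact le_trans (by linarith) (le_abs_self _)
      have hbne : ∀ᶠ n in atTop, b n ≠ 0 :=
        (eventually_ge_atTop 1).mono fun n hn => (hb n hn).ne'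
      have ho : (fun n => ∑ k ∈ Finset.Ioc 0 n, x k i * e k) =o[atTop] b :=
        (isLittleO_iff_tendsto' (hbne.mono fun n hn h0 => absurd h0 hn)).2 (hnoise i)
      refine ((hO.mul_isLittleO ho).trans_isBigO
        (IsBigO.of_bound (g := fun _ => (1 : ℝ)) 1 ?_)).tendsto_zero_of_tendsto tendsto_const_nhds
      filter_upwards [hbne] with n hn
      rw [one_div_mul_cancel hn, one_mul]
    have hsum := tendsto_finsetSum (Finset.univ : Finset (Fin p)) fun i _ => hterm i
    simpa [Matrix.mulVec, dotProduct] using hsum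
  rw [add_zero] at hlim
  refine hlim.congr' ?_
  filter_upwards [eventually_ge_atTop m] with n hn
  exact (lsEstimate_eq hy (isUnit_gram_mono hn hm)).symm

lemma rpow_mul_inv_Log_isBigO (r : ℝ) :
    (fun n : ℕ => (n : ℝ) ^ (-(1 / r)) * (Log n)⁻¹) =O[atTop] fun n => 1 / rate (1 / r) n := by
  -- For `n ≥ 3` one has `1 ≤ log n`, whence `2 + log n ≤ 3 * log n`.
  refine IsBigO.of_bound 3 ?_
  filter_upwards [eventually_ge_atTop 3] with n hn
  have h0 : (0 : ℝ) < n := by exact_mod_cast (by omega : 0 < n)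
  have hL := one_le_Log n
  have hq : 0 < (n : ℝ) ^ (1 / r) := Real.rpow_pos_of_pos h0 _
  have hpos := two_add_log_pos n
  rw [Real.norm_of_nonneg (by positivity), Real.norm_of_nonneg
    (one_div_pos.2 (rate_pos (by omega))).le, rate, Real.rpow_neg h0.le, ← mul_inv, ← one_div,
    mul_one_div, div_le_div_iff₀ (by positivity) (by positivity), one_mul]
  rw [Log_of_three_le hn] at hL ⊢
  nlinarith

end LeastSquares

end PQDRegression

/-! ### Consistency of the estimator. -/

theorem theorem4 {Ω : Type*} [MeasurableSpace Ω] (P : Measure Ω) [IsProbabilityMeasure P]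
    (p : ℕ) (β : Fin p → ℝ) (x : ℕ → Fin p → ℝ) (ε y : ℕ → Ω → ℝ) (r : ℝ)
    (hr1 : 1 ≤ r) (hr2 : r < 2)
    (hmodel : ∀ i, 1 ≤ i → ∀ ω, y i ω = ∑ j, x i j * β j + ε i ω)
    (hmeas : ∀ n, 1 ≤ n → Measurable (ε n))
    (hident : ∀ n, 1 ≤ n → IdentDistrib (ε n) (ε 1) P P)
    (hpqd : PairwisePQD P ε)
    (hLr : MemLp (ε 1) (ENNReal.ofReal r) P)
    (hmean : ∫ ω, ε 1 ω ∂P = 0)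
    (hnonsing : ∃ n, IsUnit ((design x n)ᵀ * design x n))
    (hbdd : ∀ j, ∃ M : ℝ, ∀ n : ℕ, 1 ≤ n → (∑ k ∈ Finset.Icc 1 n, x k j ^ 2) / n ≤ M)
    (hcond :
      (r = 1 ∧
        (∀ j, (fun n : ℕ => ((design x n)ᵀ * design x n)⁻¹ j j) =O[atTop]
          fun n : ℕ => 1 / (n : ℝ)) ∧
        ∀ i j, weightedCovSum P ε (fun k => x k i) (fun l => x l j)
          (fun l => (l : ℝ)) (fun t => 1 / t ^ 3) < ∞) ∨
      (1 < r ∧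
        (∀ j, (fun n : ℕ => ((design x n)ᵀ * design x n)⁻¹ j j) =O[atTop]
          fun n : ℕ => (n : ℝ) ^ (-(1 / r)) * (Log n)⁻¹) ∧
        ∃ C : ℝ, 0 < C ∧ ∀ i j, ∃ u : ℕ → ℝ, u =o[atTop] level r ∧
          weightedCovSum P ε (fun k => x k i) (fun l => x l j)
            (fun l => C * level r l + u l) kernel < ∞)) :
    ∀ᵐ ω ∂P, Tendsto (fun n => lsEstimate (design x n) (obs (fun i => y i ω) n))
      atTop (𝓝 β) := by
  have hsq : ∀ j, ∃ M : ℝ, ∀ n : ℕ, ∑ k ∈ Finset.Ioc 0 n, x k j ^ 2 ≤ M * n := by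
    intro j
    obtain ⟨M, hM⟩ := hbdd j
    refine ⟨M, fun n => ?_⟩
    rcases Nat.eq_zero_or_pos n with rfl | hn
    · simp
    · have h := hM n hn
      rwa [div_le_iff₀ (by exact_mod_cast hn)] at h
  rcases hcond with ⟨rfl, hinv, hfin⟩ | ⟨hr, hinv, C, hC, hfin⟩
  · have hnoise : ∀ j, ∀ᵐ ω ∂P, Tendsto (fun n : ℕ =>
        (∑ k ∈ Finset.Ioc 0 n, x k j * ε k ω) / n) atTop (𝓝 0) := fun j => by
      obtain ⟨M, hM⟩ := hsq j
      exact ae_tendsto_weighted_sum_div hmeas hident hpqd hLr hmean hM (hfin j j)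
    filter_upwards [ae_all_iff.2 hnoise] with ω hω
    exact tendsto_lsEstimate (fun i hi => hmodel i hi ω) hnonsing
      (fun n hn => by exact_mod_cast hn) hinv hω
  · have hnoise : ∀ j, ∀ᵐ ω ∂P, Tendsto (fun n : ℕ =>
        (∑ k ∈ Finset.Ioc 0 n, x k j * ε k ω) / rate (1 / r) n) atTop (𝓝 0) := fun j => by
      obtain ⟨M, hM⟩ := hsq j
      obtain ⟨u, hu, hfinu⟩ := hfin j j
      exact ae_tendsto_weighted_sum_div_rate hmeas hident hpqd hr hr2 hLr hmean hM hC hu hfinu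
    filter_upwards [ae_all_iff.2 hnoise] with ω hω
    exact tendsto_lsEstimate (fun i hi => hmodel i hi ω) hnonsing (fun n hn => rate_pos hn)
      (fun j => (hinv j).trans (rpow_mul_inv_Log_isBigO r)) hω
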